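/- Let $d\ge 0$ be an integer, with $\mathbb R^d$ carrying the Euclidean norm. Call $\kappa:\mathbb R^d\to(0,\infty)$ a companion-elliptic kernel if: (1) $\kappa\in C(\mathbb R^d)\cap L^1(\mathbb R^d)\cap W^{1,\infty}(\mathbb R^d)$, where $W^{1,\infty}(\mathbb R^d)$ is the space of functions that lie in $L^\infty(\mathbb R^d)$ together with their weak gradient; (2) there are constants $c_1,c_2,\lambda_0>0$, $\lambda_1\ge 0$ and a strictly positive function $\eta\in C^2(\mathbb R^d)$ such that $\eta,\nabla\eta\in C_0(\mathbb R^d)\cap L^1(\mathbb R^d)\cap L^\infty(\mathbb R^d)$ (here $C_0$ means continuous and tending to $0$ at infinity), $\nabla^2\eta\in L^\infty(\mathbb R^d)$, and $$\nabla\eta(z)=-\frac{z}{c_1}\,\kappa(z),\qquad \lambda_0\,\eta(z)-\lambda_1\,\Delta\eta(z)=c_2\,\kappa(z)\qquad\text{for all } z\in\mathbb R^d.$$ For a Borel function $\kappa:\mathbb R^d\to(0,\infty)$ and a Borel probability measure $r$ on $\mathbb R^d$ put $u_r^\kappa(x)=\int\kappa(x-y)\,r(dy)\in(0,\infty]$,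 $$D_r^\kappa=\Bigl\{x\in\mathbb R^d:\ u_r^\kappa(x)<\infty\ \text{and}\ \int\|y-x\|\,\kappa(x-y)\,r(dy)<\infty\Bigr\},$$ and, for $x\in D_r^\kappa$, $$a_r^\kappa(x)=x+\frac{1}{u_r^\kappa(x)}\int(y-x)\,\kappa(x-y)\,r(dy).$$ For Borel probability measures $p,q$ on $\mathbb R^d$ the drift field is the map $V_{p,q}^\kappa=a_p^\kappa-a_q^\kappa$ on the domain $D_{p,q}^\kappa=D_p^\kappa\cap D_q^\kappa$. **Theorem.** Let $\kappa$ be a companion-elliptic kernel, and let $p,q$ be Borel probability measures on $\mathbb R^d$. Then $D_{p,q}^\kappa=\mathbb R^d$, that is, $V_{p,q}^\kappa$ is defined on all of $\mathbb R^d$. Moreover, if $V_{p,q}^\kappa(x)=0$ for all $x\in\mathbb R^d$, then $p=q$. -/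

import Mathlib

open MeasureTheory Filter Topology
open scoped ENNReal ContDiff Gradient Laplacian

/-- The Euclidean space `ℝ^d`. -/
abbrev Rd (d : ℕ) : Type := EuclideanSpace ℝ (Fin d)

/-! ### Function spaces -/

/-- `f ∈ C₀(ℝ^d; F)`: `f` is continuous and `f x → 0` as `‖x‖ → ∞`. -/
def MemC0 {d : ℕ} {F : Type*} [NormedAddCommGroup F] (f : Rd d → F) : Prop :=
  Continuous f ∧ Tendsto f (cocompact (Rd d)) (𝓝 0)

/-- `g` is the weak (distributional) gradient of `f` on `ℝ^d`: both are locally integrable and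
`∫ f ∂_v φ = - ∫ φ ⟨g, v⟩` for all test functions `φ ∈ C_c^∞(ℝ^d)` and all directions `v`. -/
def HasWeakGradient {d : ℕ} (f : Rd d → ℝ) (g : Rd d → Rd d) : Prop :=
  LocallyIntegrable f volume ∧ LocallyIntegrable g volume ∧
    ∀ φ : Rd d → ℝ, ContDiff ℝ ∞ φ → HasCompactSupport φ → ∀ v : Rd d,
      ∫ x, f x * fderiv ℝ φ x v = - ∫ x, φ x * inner ℝ (g x) v

/-- `f ∈ W^{1,∞}(ℝ^d)`: `f` and its weak gradient lie in `L^∞(ℝ^d)`. -/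
def MemW1Infty {d : ℕ} (f : Rd d → ℝ) : Prop :=
  MemLp f ⊤ volume ∧ ∃ g : Rd d → Rd d, HasWeakGradient f g ∧ MemLp g ⊤ volume

/-! ### The translation-invariant drift -/

section Drift

variable {d : ℕ}

/-- `u_r^κ(x) = ∫ κ(x - y) r(dy) ∈ [0, ∞]`, for a nonnegative kernel `κ`. -/
noncomputable def kernelMass (κ : Rd d → ℝ) (r : Measure (Rd d)) (x : Rd d) : ℝ≥0∞ :=
  ∫⁻ y, ENNReal.ofReal (κ (x - y)) ∂r

/-- The barycenter domain `D_r^κ`: the points `x` at which `u_r^κ(x) < ∞` and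
`∫ ‖y - x‖ κ(x - y) r(dy) < ∞`. -/
def barycenterDomain (κ : Rd d → ℝ) (r : Measure (Rd d)) : Set (Rd d) :=
  {x | kernelMass κ r x < ⊤ ∧ ∫⁻ y, ENNReal.ofReal (‖y - x‖ * κ (x - y)) ∂r < ⊤}

/-- The centered kernel moment `w_r^κ(x) = ∫ (y - x) κ(x - y) r(dy)`, for `x ∈ D_r^κ`. -/
noncomputable def centeredMoment (κ : Rd d → ℝ) (r : Measure (Rd d)) (x : Rd d) : Rd d :=
  ∫ y, κ (x - y) • (y - x) ∂r

/-- The normalized local barycenter `a_r^κ(x) = x + w_r^κ(x) / u_r^κ(x)`, for `x ∈ D_r^κ`. -/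
noncomputable def localBarycenter (κ : Rd d → ℝ) (r : Measure (Rd d)) (x : Rd d) : Rd d :=
  x + (kernelMass κ r x).toReal⁻¹ • centeredMoment κ r x

/-- The domain `D_{p,q}^κ = D_p^κ ∩ D_q^κ` of the drift field. -/
def driftDomain (κ : Rd d → ℝ) (p q : Measure (Rd d)) : Set (Rd d) :=
  barycenterDomain κ p ∩ barycenterDomain κ q

/-- The drift field `V_{p,q}^κ = a_p^κ - a_q^κ`, a map on its domain `D_{p,q}^κ`. -/
noncomputable def driftField (κ : Rd d → ℝ) (p q : Measure (Rd d)) (x : driftDomain κ p q) : Rd d :=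
  localBarycenter κ p x - localBarycenter κ q x

/-- For a positive Borel kernel the normalizing factor is never zero, and on the barycenter domain
it is finite and the integral defining the moment converges, so that `a_r^κ` there is a genuine
quotient. -/
theorem barycenter_wellDefined {κ : Rd d → ℝ} (hκ : Measurable κ) (hpos : ∀ z, 0 < κ z)
    (r : Measure (Rd d)) [IsProbabilityMeasure r] {x : Rd d} (hx : x ∈ barycenterDomain κ r) :
    0 < (kernelMass κ r x).toReal ∧ Integrable (fun y => κ (x - y) • (y - x)) r := by
  have hm : Measurable fun y => κ (x - y) := hκ.comp (measurable_const.sub measurable_id)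
  refine ⟨ENNReal.toReal_pos ?_ hx.1.ne, ?_⟩
  · refine (lintegral_pos_iff_support hm.ennreal_ofReal).2 ?_ |>.ne'
    have : (Function.support fun y => ENNReal.ofReal (κ (x - y))) = Set.univ := by
      ext y; simp [hpos]
    simp [this]
  · refine ⟨(hm.smul (measurable_id.sub measurable_const)).aestronglyMeasurable, ?_⟩
    rw [hasFiniteIntegral_iff_norm]
    convert hx.2 using 4 with y
    rw [norm_smul, Real.norm_of_nonneg (hpos _).le, mul_comm]

end Drift

/-! ### The companion-elliptic class -/

/-- `η` is a companion of the kernel `κ`, with constants `c₁, c₂, l₀, l₁` (the last two are written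
`λ₀, λ₁` in mathematical notation). -/
structure IsCompanion {d : ℕ} (κ η : Rd d → ℝ) (c₁ c₂ l₀ l₁ : ℝ) : Prop where
  c₁_pos : 0 < c₁
  c₂_pos : 0 < c₂
  l₀_pos : 0 < l₀
  l₁_nonneg : 0 ≤ l₁
  contDiff : ContDiff ℝ 2 η
  pos : ∀ z, 0 < η z
  memC0 : MemC0 η
  integrable : Integrable η volume
  memLp_top : MemLp η ⊤ volume
  gradient_memC0 : MemC0 (∇ η)
  gradient_integrable : Integrable (∇ η) volume
  gradient_memLp_top : MemLp (∇ η) ⊤ volume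
  /-- The Hessian of `η` is in `L^∞`. -/
  hessian_memLp_top : MemLp (iteratedFDeriv ℝ 2 η) ⊤ volume
  gradient_eq : ∀ z, ∇ η z = -((κ z / c₁) • z)
  elliptic_eq : ∀ z, l₀ * η z - l₁ * (Δ η) z = c₂ * κ z

/-- The companion-elliptic kernel class. -/
structure CompanionElliptic {d : ℕ} (κ : Rd d → ℝ) : Prop where
  pos : ∀ z, 0 < κ z
  continuous : Continuous κ
  integrable : Integrable κ volume
  memW1Infty : MemW1Infty κ
  exists_companion : ∃ (c₁ c₂ l₀ l₁ : ℝ) (η : Rd d → ℝ), IsCompanion κ η c₁ c₂ l₀ l₁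

/-! For a probability measure `r` put `H = η * r`, `u = κ * r`, `B = ∇H = ∇η * r`. The gradient
relation turns the centered moment into `c₁ B`, and the elliptic relation survives convolution: `l₀
H - l₁ div B = c₂ u` (`IsCompanion.ellipticPotential`). Boundedness of `κ` and `∇η` makes the drift
defined everywhere, and its vanishing says `B₁ = m B₂` with `m = u₁ / u₂`, the indices 1, 2 standing
for `p`, `q`.

The heart is to show that the defect `G = H₁ - m H₂` vanishes. Where `B₂ ≠ 0`, the ratio `m` is
`C¹`; comparing the two elliptic equations gives `l₁ ∇m · B₂ = l₀ G`, while `∇G = -H₂ ∇m`, so `l₁ ∇G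
· B₂ = -l₀ H₂ G` (`fderiv_defect`). For a convex `φ ≥ 0` with `φ(0) = 0` this yields `l₁ div(φ(G)
B₂) = -l₀ H₂ (G φ'(G) - φ(G)) - c₂ u₂ φ(G) ≤ -c₂ u₂ φ(G)`. A divergence should integrate to zero,
which forces `φ(G) = 0`. Two cutoffs justify this: one in space, whose error vanishes because `φ(G)
‖B₂‖` is integrable (`softAbs_defect_mul_norm_le`), and one away from the zeros of `B₂`
(`tendsto_integral_criticalError`). Continuity, and the elliptic equations inside `{B₂ = 0}`, give
`G = 0` everywhere (`defect_eq_zero`).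

Now `H₁ / H₂ = u₁ / u₂`, so `∇(H₁ / H₂) = 0` and `H₁ = k H₂`. The Fourier transform of `η` has no
zero: along each ray the cosine transform of `κ` solves a homogeneous linear ODE with positive
initial value (`cos_transform_pos`). Hence the characteristic functions of `p` and `q` are
proportional, and their value at `0` gives `k = 1`. -/

/-! ### Divergence of vector fields on `ℝ^d` -/

/-- The divergence `∑ i, ∂ᵢ Xᵢ` of a vector field. -/
noncomputable def divergence {d : ℕ} (X : Rd d → Rd d) (x : Rd d) : ℝ :=
  ∑ i, (fderiv ℝ X x (EuclideanSpace.single i 1)) i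

theorem sum_apply_mul_single {d : ℕ} (L : Rd d →L[ℝ] ℝ) (v : Rd d) :
    ∑ i, L (EuclideanSpace.single i 1) * v i = L v := by
  conv_rhs => rw [← (EuclideanSpace.basisFun (Fin d) ℝ).sum_repr v]
  simp [mul_comm]

theorem divergence_smul {d : ℕ} {f : Rd d → ℝ} {X : Rd d → Rd d} {x : Rd d}
    (hf : DifferentiableAt ℝ f x) (hX : DifferentiableAt ℝ X x) :
    divergence (fun y => f y • X y) x = fderiv ℝ f x (X x) + f x * divergence X x := by
  simp only [divergence]
  rw [fderiv_fun_smul hf hX, Finset.mul_sum, ← sum_apply_mul_single (fderiv ℝ f x) (X x),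
    ← Finset.sum_add_distrib]
  refine Finset.sum_congr rfl fun i _ => ?_
  simp [add_comm]

theorem continuous_divergence {d : ℕ} {X : Rd d → Rd d} (hX : ContDiff ℝ 1 X) :
    Continuous (divergence X) := by
  have h := hX.continuous_fderiv one_ne_zero
  refine continuous_finsetSum _ fun i _ => ?_
  exact (EuclideanSpace.proj (𝕜 := ℝ) i).continuous.comp (h.clm_apply continuous_const)

theorem divergence_eq_zero_of_eventuallyEq_zero {d : ℕ} {X : Rd d → Rd d} {x : Rd d}
    (h : X =ᶠ[𝓝 x] fun _ => 0) : divergence X x = 0 := by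
  simp [divergence, h.fderiv_eq]

/-- The divergence of a compactly supported `C¹` vector field has integral zero. -/
theorem integral_divergence_eq_zero_of_hasCompactSupport {d : ℕ} {X : Rd d → Rd d}
    (hX : ContDiff ℝ 1 X) (hc : HasCompactSupport X) : ∫ x, divergence X x = 0 := by
  have hcf : ∀ v, HasCompactSupport fun x => fderiv ℝ X x v := fun v => hc.fderiv_apply ℝ v
  have hint : ∀ v, Integrable (fun x => fderiv ℝ X x v) :=
    fun v => ((hX.continuous_fderiv one_ne_zero).clm_apply continuous_const
      ).integrable_of_hasCompactSupport (hcf v)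
  have h0 : ∀ v, ∫ x, fderiv ℝ X x v = 0 := by
    intro v
    -- Integration by parts against the constant function `1`.
    have := integral_smul_fderiv_eq_neg_fderiv_smul_of_integrable (𝕜 := ℝ) (μ := volume)
      (f := fun _ : Rd d => (1 : ℝ)) (g := X) (v := v) (by simp) (by simpa using hint v)
      (by simpa using hX.continuous.integrable_of_hasCompactSupport hc)
      (fun x _ => by fun_prop) (fun x _ => hX.differentiable one_ne_zero x)
    simpa using this
  simp only [divergence]
  rw [integral_finsetSum]
  · refine Finset.sum_eq_zero fun i _ => ?_
    have := (EuclideanSpace.proj (𝕜 := ℝ) i).integral_comp_comm (hint (EuclideanSpace.single i 1))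
    rw [h0] at this
    simpa using this
  · exact fun i _ => (EuclideanSpace.proj (𝕜 := ℝ) i).integrable_comp (hint _)

/-- Smooth cutoffs at scale `R`, with gradient of size `O(1 / R)`. -/
theorem exists_cutoff (d : ℕ) : ∃ C : ℝ, 0 ≤ C ∧ ∀ R : ℝ, 0 < R → ∃ χ : Rd d → ℝ,
    ContDiff ℝ 1 χ ∧ HasCompactSupport χ ∧ (∀ x, 0 ≤ χ x ∧ χ x ≤ 1) ∧
    (∀ x, ‖x‖ ≤ R → χ x = 1) ∧ ∀ x, ‖fderiv ℝ χ x‖ ≤ C / R := by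
  let χ : ContDiffBump (0 : Rd d) := ⟨1, 2, one_pos, one_lt_two⟩
  have hχ : ContDiff ℝ 1 χ := χ.contDiff
  obtain ⟨C, hC⟩ := ((hχ.continuous_fderiv one_ne_zero).bounded_above_of_compact_support
    (χ.hasCompactSupport.fderiv ℝ))
  refine ⟨C, (norm_nonneg _).trans (hC 0), fun R hR => ⟨fun x => χ (R⁻¹ • x), ?_, ?_, ?_, ?_, ?_⟩⟩
  · exact hχ.comp (contDiff_const_smul _)
  · exact χ.hasCompactSupport.comp_smul (inv_ne_zero hR.ne')
  · exact fun x => ⟨χ.nonneg, χ.le_one⟩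
  · intro x hx
    apply χ.one_of_mem_closedBall
    rw [mem_closedBall_zero_iff, norm_smul, norm_inv, Real.norm_of_nonneg hR.le]
    exact (inv_mul_le_one₀ hR).2 hx
  · intro x
    have : HasFDerivAt (fun x => χ (R⁻¹ • x))
        ((fderiv ℝ χ (R⁻¹ • x)).comp (R⁻¹ • ContinuousLinearMap.id ℝ (Rd d))) x :=
      (hχ.differentiable one_ne_zero _).hasFDerivAt.comp x ((hasFDerivAt_id x).const_smul R⁻¹)
    rw [this.fderiv, ContinuousLinearMap.comp_smul, ContinuousLinearMap.comp_id, norm_smul,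
      norm_inv, Real.norm_of_nonneg hR.le, div_eq_inv_mul]
    exact mul_le_mul_of_nonneg_left (hC _) (inv_nonneg.2 hR.le)

/-- An integrable `C¹` vector field with integrable divergence has total divergence zero. -/
theorem integral_divergence_eq_zero {d : ℕ} {X : Rd d → Rd d} (hX : ContDiff ℝ 1 X)
    (hi : Integrable X) (hd : Integrable (divergence X)) : ∫ x, divergence X x = 0 := by
  obtain ⟨C, hC0, hC⟩ := exists_cutoff d
  -- Scales `n + 1 ≥ 1` keep `C / (n + 1) ≤ C`, so one integrable majorant serves all `n`.
  choose χ hχ hcs h01 hone hder using fun n : ℕ => hC (n + 1) (by positivity)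
  have key : ∀ n, ∫ x, (fderiv ℝ (χ n) x (X x) + χ n x * divergence X x) = 0 := by
    intro n
    rw [← integral_divergence_eq_zero_of_hasCompactSupport ((hχ n).smul hX) ((hcs n).smul_right)]
    refine integral_congr_ae (.of_forall fun x => ?_)
    exact (divergence_smul ((hχ n).differentiable one_ne_zero x)
      (hX.differentiable one_ne_zero x)).symm
  have hle : ∀ n x, ‖fderiv ℝ (χ n) x (X x)‖ ≤ C / (n + 1) * ‖X x‖ := fun n x =>
    ((fderiv ℝ (χ n) x).le_opNorm _).trans (mul_le_mul_of_nonneg_right (hder n x) (norm_nonneg _))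
  have hdiv : Tendsto (fun n : ℕ => C / ((n : ℝ) + 1)) atTop (𝓝 0) :=
    tendsto_const_div_atTop_nhds_zero_nat C |>.comp (tendsto_add_atTop_nat 1) |>.congr (by simp)
  have lim := tendsto_integral_of_dominated_convergence (μ := volume)
    (F := fun n x => fderiv ℝ (χ n) x (X x) + χ n x * divergence X x)
    (f := divergence X) (fun x => C * ‖X x‖ + ‖divergence X x‖)
    (fun n => ((((hχ n).continuous_fderiv one_ne_zero).clm_apply hX.continuous).add
      ((hχ n).continuous.mul (continuous_divergence hX))).aestronglyMeasurable)
    ((hi.norm.const_mul C).add hd.norm) ?_ ?_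
  · exact tendsto_nhds_unique (lim.congr key) tendsto_const_nhds |>.symm ▸ rfl
  · refine fun n => .of_forall fun x => (norm_add_le _ _).trans (add_le_add ?_ ?_)
    · refine (hle n x).trans (mul_le_mul_of_nonneg_right ?_ (norm_nonneg _))
      exact div_le_self hC0 (by simp)
    · rw [norm_mul, Real.norm_of_nonneg (h01 n x).1]
      exact mul_le_of_le_one_left (norm_nonneg _) (h01 n x).2
  · refine .of_forall fun x => ?_
    have h1 : Tendsto (fun n => fderiv ℝ (χ n) x (X x)) atTop (𝓝 0) :=
      squeeze_zero_norm (fun n => hle n x) (by simpa using hdiv.mul_const ‖X x‖)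
    have h2 : Tendsto (fun n => χ n x * divergence X x) atTop (𝓝 (divergence X x)) := by
      refine tendsto_const_nhds.congr' ?_
      obtain ⟨N, hN⟩ := exists_nat_ge ‖x‖
      filter_upwards [eventually_ge_atTop N] with n hn
      rw [hone n x, one_mul]
      have : (N : ℝ) ≤ n := by exact_mod_cast hn
      linarith
    simpa using h1.add h2

/-! ### A smooth convex minorant of the absolute value and a smooth step -/

/-- The smooth convex function `√(1 + t²) - 1`. -/
noncomputable def softAbs (t : ℝ) : ℝ := √(1 + t ^ 2) - 1

theorem one_add_sq_pos (t : ℝ) : 0 < 1 + t ^ 2 := by positivity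

theorem one_le_sqrt_one_add_sq (t : ℝ) : 1 ≤ √(1 + t ^ 2) :=
  Real.one_le_sqrt.2 (by nlinarith [sq_nonneg t])

theorem contDiff_softAbs : ContDiff ℝ 1 softAbs :=
  ((contDiff_const.add (contDiff_id.pow 2)).sqrt fun t => (one_add_sq_pos t).ne').sub
    contDiff_const

theorem softAbs_nonneg (t : ℝ) : 0 ≤ softAbs t := sub_nonneg.2 (one_le_sqrt_one_add_sq t)

theorem softAbs_pos {t : ℝ} (ht : t ≠ 0) : 0 < softAbs t := by
  refine sub_pos.2 ?_
  rw [Real.lt_sqrt zero_le_one]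
  have : 0 < t ^ 2 := by positivity
  linarith

/-- Linear growth is what lets the integrability of `H₁ ‖B₂‖ + H₂ ‖B₁‖` control the spatial cutoff
error. -/
theorem softAbs_le_abs (t : ℝ) : softAbs t ≤ |t| := by
  rw [softAbs, sub_le_iff_le_add, Real.sqrt_le_left (by positivity)]
  nlinarith [sq_abs t, abs_nonneg t]

theorem hasDerivAt_softAbs (t : ℝ) : HasDerivAt softAbs (t / √(1 + t ^ 2)) t := by
  have h : HasDerivAt (fun s : ℝ => 1 + s ^ 2) (2 * t) t := by
    simpa using (hasDerivAt_pow 2 t).const_add 1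
  have := (h.sqrt (one_add_sq_pos t).ne').sub_const 1
  rwa [mul_div_mul_left _ _ two_ne_zero] at this

/-- Convexity together with the value `0` at the origin; explicitly, with `s = √(1 + t²) ≥ 1`, it
reads `(s - 1) s ≤ s² - 1`. It fixes the sign of the zeroth-order term in the energy identity. -/
theorem softAbs_le_mul_deriv (t : ℝ) : softAbs t ≤ t * deriv softAbs t := by
  rw [(hasDerivAt_softAbs t).deriv, softAbs, ← mul_div_assoc, le_div_iff₀
    (zero_lt_one.trans_le (one_le_sqrt_one_add_sq t))]
  nlinarith [one_le_sqrt_one_add_sq t, Real.sq_sqrt (one_add_sq_pos t).le]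

/-- A smooth step, equal to `0` on `(-∞, 1]` and to `1` on `[2, ∞)`. -/
noncomputable def smoothStep (s : ℝ) : ℝ := Real.smoothTransition (s - 1)

theorem contDiff_smoothStep : ContDiff ℝ 1 smoothStep :=
  (Real.smoothTransition.contDiff (n := 1)).comp (contDiff_id.sub contDiff_const)

theorem smoothStep_of_le_one {s : ℝ} (hs : s ≤ 1) : smoothStep s = 0 :=
  Real.smoothTransition.zero_of_nonpos (by linarith)

theorem smoothStep_of_two_le {s : ℝ} (hs : 2 ≤ s) : smoothStep s = 1 :=
  Real.smoothTransition.one_of_one_le (by linarith)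

theorem deriv_smoothStep_of_lt_one {s : ℝ} (hs : s < 1) : deriv smoothStep s = 0 := by
  have : smoothStep =ᶠ[𝓝 s] fun _ => 0 := by
    filter_upwards [Iio_mem_nhds hs] with t ht using smoothStep_of_le_one (le_of_lt ht)
  rw [this.deriv_eq, deriv_const]

theorem deriv_smoothStep_of_two_lt {s : ℝ} (hs : 2 < s) : deriv smoothStep s = 0 := by
  have : smoothStep =ᶠ[𝓝 s] fun _ => 1 := by
    filter_upwards [Ioi_mem_nhds hs] with t ht using smoothStep_of_two_le (le_of_lt ht)
  rw [this.deriv_eq, deriv_const]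

/-- The quantity `s ψ'(s)` is invariant under rescaling the step, so this bounds the critical-point
error uniformly in the localization parameter `n`. -/
theorem exists_abs_mul_deriv_smoothStep_le : ∃ C : ℝ, ∀ s, |s * deriv smoothStep s| ≤ C := by
  have hc : Continuous fun s => s * deriv smoothStep s :=
    continuous_id.mul (contDiff_smoothStep.continuous_deriv le_rfl)
  refine (hc.bounded_above_of_compact_support (HasCompactSupport.intro
    (isCompact_Icc (a := (1 : ℝ)) (b := 2)) fun s hs => ?_)).imp fun C h => h
  rw [Set.mem_Icc, not_and_or, not_le, not_le] at hs
  rcases hs with h | h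
  · rw [deriv_smoothStep_of_lt_one h, mul_zero]
  · rw [deriv_smoothStep_of_two_lt h, mul_zero]

/-! ### Rigidity of elliptic potentials with proportional gradients -/

/-- `H` is a positive bounded potential with integrable gradient `B`, solving
`l₀ H - l₁ div B = c₂ u` with a positive continuous right-hand side. -/
structure EllipticPotential {d : ℕ} (c₂ l₀ l₁ : ℝ) (H u : Rd d → ℝ) (B : Rd d → Rd d) : Prop where
  hasFDerivAt : ∀ x, HasFDerivAt H (innerSL ℝ (B x)) x
  contDiff : ContDiff ℝ 1 B
  pos : ∀ x, 0 < H x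
  source_pos : ∀ x, 0 < u x
  source_continuous : Continuous u
  elliptic : ∀ x, l₀ * H x - l₁ * divergence B x = c₂ * u x
  bounded : ∃ M, ∀ x, H x ≤ M
  fderiv_bounded : ∃ M, ∀ x, ‖fderiv ℝ B x‖ ≤ M
  integrable : Integrable B

namespace EllipticPotential

variable {d : ℕ} {c₂ l₀ l₁ : ℝ} {H₁ H₂ u₁ u₂ : Rd d → ℝ} {B₁ B₂ : Rd d → Rd d}

/-- The defect `H₁ - (u₁ / u₂) H₂`. -/
noncomputable def defect (H₁ H₂ u₁ u₂ : Rd d → ℝ) (x : Rd d) : ℝ := H₁ x - u₁ x / u₂ x * H₂ x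

theorem continuous (h : EllipticPotential c₂ l₀ l₁ H₁ u₁ B₁) : Continuous H₁ :=
  continuous_iff_continuousAt.2 fun x => (h.hasFDerivAt x).continuousAt

theorem contDiff_potential (h : EllipticPotential c₂ l₀ l₁ H₁ u₁ B₁) : ContDiff ℝ 1 H₁ := by
  rw [contDiff_one_iff_hasFDerivAt]
  exact ⟨_, (innerSL ℝ).continuous.comp h.contDiff.continuous, h.hasFDerivAt⟩

theorem continuous_defect (h₁ : EllipticPotential c₂ l₀ l₁ H₁ u₁ B₁)
    (h₂ : EllipticPotential c₂ l₀ l₁ H₂ u₂ B₂) : Continuous (defect H₁ H₂ u₁ u₂) :=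
  h₁.continuous.sub ((h₁.source_continuous.div h₂.source_continuous
    fun x => (h₂.source_pos x).ne').mul h₂.continuous)

theorem eq_smul (h₂ : EllipticPotential c₂ l₀ l₁ H₂ u₂ B₂)
    (hB : ∀ x, u₂ x • B₁ x = u₁ x • B₂ x) (x : Rd d) : B₁ x = (u₁ x / u₂ x) • B₂ x := by
  rw [div_eq_inv_mul, mul_smul, ← hB, smul_smul, inv_mul_cancel₀ (h₂.source_pos x).ne', one_smul]

/-- The sources are only known to be continuous, but off the zeros of `B₂` their ratio can be
recovered from the `C¹` gradients by projecting `B₁` onto `B₂`. -/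
theorem contDiffAt_ratio (h₁ : EllipticPotential c₂ l₀ l₁ H₁ u₁ B₁)
    (h₂ : EllipticPotential c₂ l₀ l₁ H₂ u₂ B₂) (hB : ∀ x, u₂ x • B₁ x = u₁ x • B₂ x)
    {x : Rd d} (hx : B₂ x ≠ 0) : ContDiffAt ℝ 1 (fun y => u₁ y / u₂ y) x := by
  have : ContDiffAt ℝ 1 (fun y => inner ℝ (B₁ y) (B₂ y) / ‖B₂ y‖ ^ 2) x :=
    (h₁.contDiff.inner ℝ h₂.contDiff).contDiffAt.div (h₂.contDiff.norm_sq ℝ).contDiffAt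
      (by simpa using hx)
  refine this.congr_of_eventuallyEq ?_
  filter_upwards [h₂.contDiff.continuous.continuousAt.eventually_ne hx] with y hy
  have : ‖B₂ y‖ ≠ 0 := norm_ne_zero_iff.2 hy
  rw [h₂.eq_smul hB y, real_inner_smul_left, real_inner_self_eq_norm_sq]
  field_simp

theorem contDiffAt_defect (h₁ : EllipticPotential c₂ l₀ l₁ H₁ u₁ B₁)
    (h₂ : EllipticPotential c₂ l₀ l₁ H₂ u₂ B₂) (hB : ∀ x, u₂ x • B₁ x = u₁ x • B₂ x)
    {x : Rd d} (hx : B₂ x ≠ 0) : ContDiffAt ℝ 1 (defect H₁ H₂ u₁ u₂) x :=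
  h₁.contDiff_potential.contDiffAt.sub
    ((h₁.contDiffAt_ratio h₂ hB hx).mul h₂.contDiff_potential.contDiffAt)

/-- The defect solves a transport equation along `B₂`. -/
theorem fderiv_defect (h₁ : EllipticPotential c₂ l₀ l₁ H₁ u₁ B₁)
    (h₂ : EllipticPotential c₂ l₀ l₁ H₂ u₂ B₂) (hB : ∀ x, u₂ x • B₁ x = u₁ x • B₂ x)
    {x : Rd d} (hx : B₂ x ≠ 0) :
    l₁ * fderiv ℝ (defect H₁ H₂ u₁ u₂) x (B₂ x) = -(l₀ * H₂ x * defect H₁ H₂ u₁ u₂ x) := by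
  have hm := (h₁.contDiffAt_ratio h₂ hB hx).differentiableAt one_ne_zero
  have hdiv := divergence_smul hm (h₂.contDiff.differentiable one_ne_zero x)
  rw [← show B₁ = fun y => (u₁ y / u₂ y) • B₂ y from funext (h₂.eq_smul hB)] at hdiv
  have hG := (h₁.hasFDerivAt x).sub (hm.hasFDerivAt.mul (h₂.hasFDerivAt x))
  -- Since `B₁ = m B₂`, the terms from `∇H₁` and `m ∇H₂` cancel and only the derivative of `m`
  -- remains; the elliptic equations then identify it through `l₁ ∇m · B₂ = l₀ G`.
  have hG' : fderiv ℝ (defect H₁ H₂ u₁ u₂) x (B₂ x) =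
      -(H₂ x * fderiv ℝ (fun y => u₁ y / u₂ y) x (B₂ x)) := by
    rw [show defect H₁ H₂ u₁ u₂ = H₁ - (fun y => u₁ y / u₂ y) * H₂ from rfl, hG.fderiv]
    simp only [sub_apply, add_apply,
      smul_apply, innerSL_apply_apply, smul_eq_mul]
    rw [h₂.eq_smul hB x, real_inner_smul_left]
    ring
  have hu : u₁ x = u₁ x / u₂ x * u₂ x := (div_mul_cancel₀ _ (h₂.source_pos x).ne').symm
  have e₁ := h₁.elliptic x
  have e₂ := h₂.elliptic x
  rw [hG', defect]
  generalize u₁ x / u₂ x = m at *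
  rw [hdiv, hu] at e₁
  linear_combination (-H₂ x) * (m * e₂ - e₁)

/-- Both gradients vanish near the point, hence so do their divergences there, and the equations
reduce to `l₀ H = c₂ u` for each potential. -/
theorem defect_eq_zero_of_eventuallyEq_zero (h₁ : EllipticPotential c₂ l₀ l₁ H₁ u₁ B₁)
    (h₂ : EllipticPotential c₂ l₀ l₁ H₂ u₂ B₂) (hl₀ : 0 < l₀)
    (hB : ∀ x, u₂ x • B₁ x = u₁ x • B₂ x) {x : Rd d} (hx : B₂ =ᶠ[𝓝 x] fun _ => 0) :
    defect H₁ H₂ u₁ u₂ x = 0 := by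
  have hx₁ : B₁ =ᶠ[𝓝 x] fun _ => 0 := by
    filter_upwards [hx] with y hy
    rw [h₂.eq_smul hB, hy, smul_zero]
  have e₁ := h₁.elliptic x
  have e₂ := h₂.elliptic x
  rw [divergence_eq_zero_of_eventuallyEq_zero hx₁] at e₁
  rw [divergence_eq_zero_of_eventuallyEq_zero hx] at e₂
  have hu : u₁ x = u₁ x / u₂ x * u₂ x := (div_mul_cancel₀ _ (h₂.source_pos x).ne').symm
  rw [defect]
  generalize u₁ x / u₂ x = m at *
  rw [hu] at e₁
  refine (mul_eq_zero.1 (?_ : l₀ * _ = 0)).resolve_left hl₀.ne'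
  linear_combination e₁ - m * e₂

/-- The localized test function: a cutoff `χ`, times a cutoff away from the critical points of
`H₂`, times a convex function of the defect. -/
noncomputable def testFun (H₁ H₂ u₁ u₂ : Rd d → ℝ) (B₂ : Rd d → Rd d) (χ : Rd d → ℝ) (n : ℕ)
    (x : Rd d) : ℝ :=
  χ x * smoothStep (n * ‖B₂ x‖ ^ 2) * softAbs (defect H₁ H₂ u₁ u₂ x)

theorem testFun_eventuallyEq_zero (h₂ : EllipticPotential c₂ l₀ l₁ H₂ u₂ B₂) (χ : Rd d → ℝ)
    (n : ℕ) {x : Rd d} (hx : B₂ x = 0) : testFun H₁ H₂ u₁ u₂ B₂ χ n =ᶠ[𝓝 x] fun _ => 0 := by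
  have hc : Continuous fun y => n * ‖B₂ y‖ ^ 2 :=
    continuous_const.mul (h₂.contDiff.continuous.norm.pow 2)
  have : ∀ᶠ y in 𝓝 x, n * ‖B₂ y‖ ^ 2 < 1 :=
    hc.continuousAt.eventually_lt continuousAt_const (by simp [hx])
  filter_upwards [this] with y hy
  rw [testFun, smoothStep_of_le_one hy.le, mul_zero, zero_mul]

theorem contDiff_localization (h₂ : EllipticPotential c₂ l₀ l₁ H₂ u₂ B₂) (n : ℕ) :
    ContDiff ℝ 1 fun x => smoothStep (n * ‖B₂ x‖ ^ 2) :=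
  contDiff_smoothStep.comp (contDiff_const.mul (h₂.contDiff.norm_sq ℝ))

theorem contDiff_testFun (h₁ : EllipticPotential c₂ l₀ l₁ H₁ u₁ B₁)
    (h₂ : EllipticPotential c₂ l₀ l₁ H₂ u₂ B₂) (hB : ∀ x, u₂ x • B₁ x = u₁ x • B₂ x)
    {χ : Rd d → ℝ} (hχ : ContDiff ℝ 1 χ) (n : ℕ) :
    ContDiff ℝ 1 (testFun H₁ H₂ u₁ u₂ B₂ χ n) := by
  refine contDiff_iff_contDiffAt.2 fun x => ?_
  by_cases hx : B₂ x = 0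
  · exact contDiffAt_const.congr_of_eventuallyEq (h₂.testFun_eventuallyEq_zero χ n hx)
  · exact (hχ.mul (h₂.contDiff_localization n)).contDiffAt.mul
      (contDiff_softAbs.contDiffAt.comp x (h₁.contDiffAt_defect h₂ hB hx))

/-- The error produced by localizing away from the critical points of `H₂`. -/
noncomputable def criticalError (H₁ H₂ u₁ u₂ : Rd d → ℝ) (B₂ : Rd d → Rd d) (χ : Rd d → ℝ) (n : ℕ)
    (x : Rd d) : ℝ :=
  χ x * softAbs (defect H₁ H₂ u₁ u₂ x) * (n * deriv smoothStep (n * ‖B₂ x‖ ^ 2) *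
    (2 * inner ℝ (B₂ x) (fderiv ℝ B₂ x (B₂ x))))

/-- The product rule, with the transport equation replacing the derivative of the defect and the
elliptic equation replacing `div B₂`. The last two terms have a favourable sign; the first two are
the errors of the two cutoffs. -/
theorem divergence_testFun_smul (h₁ : EllipticPotential c₂ l₀ l₁ H₁ u₁ B₁)
    (h₂ : EllipticPotential c₂ l₀ l₁ H₂ u₂ B₂) (hB : ∀ x, u₂ x • B₁ x = u₁ x • B₂ x)
    {χ : Rd d → ℝ} (hχ : ContDiff ℝ 1 χ) (n : ℕ) (x : Rd d) :
    l₁ * divergence (fun y => testFun H₁ H₂ u₁ u₂ B₂ χ n y • B₂ y) x =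
      l₁ * criticalError H₁ H₂ u₁ u₂ B₂ χ n x
      + l₁ * (smoothStep (n * ‖B₂ x‖ ^ 2) * softAbs (defect H₁ H₂ u₁ u₂ x) * fderiv ℝ χ x (B₂ x))
      - χ x * smoothStep (n * ‖B₂ x‖ ^ 2) * (l₀ * H₂ x *
        (defect H₁ H₂ u₁ u₂ x * deriv softAbs (defect H₁ H₂ u₁ u₂ x)
          - softAbs (defect H₁ H₂ u₁ u₂ x)))
      - c₂ * (testFun H₁ H₂ u₁ u₂ B₂ χ n x * u₂ x) := by
  rw [divergence_smul ((h₁.contDiff_testFun h₂ hB hχ n).differentiable one_ne_zero x)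
    (h₂.contDiff.differentiable one_ne_zero x)]
  by_cases hx : B₂ x = 0
  -- At a critical point each term contains a factor `B₂ x` or `smoothStep 0 = 0`.
  · rw [(h₂.testFun_eventuallyEq_zero χ n hx).fderiv_eq,
      (h₂.testFun_eventuallyEq_zero χ n hx).eq_of_nhds, criticalError, hx]
    simp [smoothStep_of_le_one]
  · have hG := ((h₁.contDiffAt_defect h₂ hB hx).differentiableAt one_ne_zero).hasFDerivAt
    have hφ := (contDiff_softAbs.differentiable one_ne_zero
      (defect H₁ H₂ u₁ u₂ x)).hasDerivAt.comp_hasFDerivAt x hG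
    have hN : HasFDerivAt (fun y => n * ‖B₂ y‖ ^ 2) _ x :=
      ((h₂.contDiff.differentiable one_ne_zero x).hasFDerivAt.norm_sq).const_mul (n : ℝ)
    have hψ := (contDiff_smoothStep.differentiable one_ne_zero
      (n * ‖B₂ x‖ ^ 2)).hasDerivAt.comp_hasFDerivAt x hN
    have hf : HasFDerivAt (testFun H₁ H₂ u₁ u₂ B₂ χ n) _ x :=
      ((hχ.differentiable one_ne_zero x).hasFDerivAt.mul hψ).mul hφ
    have ht := h₁.fderiv_defect h₂ hB hx
    have e₂ := h₂.elliptic x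
    rw [hf.fderiv, testFun, criticalError]
    simp only [add_apply, Function.comp_apply, Pi.mul_apply,
      smul_apply, ContinuousLinearMap.comp_apply, innerSL_apply_apply,
      smul_eq_mul, nsmul_eq_mul, Nat.cast_ofNat]
    generalize smoothStep (n * ‖B₂ x‖ ^ 2) = ψ at *
    generalize deriv smoothStep (n * ‖B₂ x‖ ^ 2) = ψ' at *
    generalize deriv softAbs (defect H₁ H₂ u₁ u₂ x) = φ' at *
    generalize softAbs (defect H₁ H₂ u₁ u₂ x) = φ at *
    linear_combination (χ x * ψ * φ') * ht - (χ x * ψ * φ) * e₂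

end EllipticPotential

/-! ### Energy inequality and vanishing of the defect -/

namespace EllipticPotential

variable {d : ℕ} {c₂ l₀ l₁ : ℝ} {H₁ H₂ u₁ u₂ : Rd d → ℝ} {B₁ B₂ : Rd d → Rd d}

theorem continuous_criticalError (h₁ : EllipticPotential c₂ l₀ l₁ H₁ u₁ B₁)
    (h₂ : EllipticPotential c₂ l₀ l₁ H₂ u₂ B₂) {χ : Rd d → ℝ} (hχ : Continuous χ) (n : ℕ) :
    Continuous (criticalError H₁ H₂ u₁ u₂ B₂ χ n) := by
  have hB := h₂.contDiff.continuous
  have hD := h₂.contDiff.continuous_fderiv one_ne_zero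
  have hG := h₁.continuous_defect h₂
  have hφ := contDiff_softAbs.continuous
  have hψ : Continuous (deriv smoothStep) := contDiff_smoothStep.continuous_deriv le_rfl
  unfold criticalError
  refine (hχ.mul (hφ.comp hG)).mul ((continuous_const.mul (hψ.comp ?_)).mul
    (continuous_const.mul (hB.inner (hD.clm_apply hB))))
  fun_prop

theorem hasCompactSupport_criticalError {χ : Rd d → ℝ} (hχ : HasCompactSupport χ) (n : ℕ) :
    HasCompactSupport (criticalError H₁ H₂ u₁ u₂ B₂ χ n) :=
  hχ.mul_right.mul_right

theorem hasCompactSupport_testFun {χ : Rd d → ℝ} (hχ : HasCompactSupport χ) (n : ℕ) :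
    HasCompactSupport (testFun H₁ H₂ u₁ u₂ B₂ χ n) :=
  hχ.mul_right.mul_right

/-- Dominated convergence. The Hessian bound makes the inner product `O(‖B₂‖²)`, and with the factor
`n` this assembles into `s ψ'(s)` at `s = n ‖B₂‖²`, which is bounded. Pointwise the error is zero
when `B₂ x = 0`, and zero as soon as `n ‖B₂ x‖² > 2` otherwise. -/
theorem tendsto_integral_criticalError (h₁ : EllipticPotential c₂ l₀ l₁ H₁ u₁ B₁)
    (h₂ : EllipticPotential c₂ l₀ l₁ H₂ u₂ B₂) {χ : Rd d → ℝ} (hχ : Continuous χ)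
    (hc : HasCompactSupport χ) :
    Tendsto (fun n : ℕ => ∫ x, criticalError H₁ H₂ u₁ u₂ B₂ χ n x) atTop (𝓝 0) := by
  obtain ⟨C, hC⟩ := exists_abs_mul_deriv_smoothStep_le
  obtain ⟨M, hM⟩ := h₂.fderiv_bounded
  have hφ : Continuous fun x => χ x * softAbs (defect H₁ H₂ u₁ u₂ x) :=
    hχ.mul (contDiff_softAbs.continuous.comp (h₁.continuous_defect h₂))
  have hi : Integrable fun x => χ x * softAbs (defect H₁ H₂ u₁ u₂ x) :=
    hφ.integrable_of_hasCompactSupport hc.mul_right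
  rw [← integral_zero (Rd d) ℝ (μ := volume)]
  refine tendsto_integral_of_dominated_convergence
    (fun x => ‖χ x * softAbs (defect H₁ H₂ u₁ u₂ x)‖ * (C * (2 * M)))
    (fun n => (h₁.continuous_criticalError h₂ hχ n).aestronglyMeasurable)
    (hi.norm.mul_const _) (fun n => .of_forall fun x => ?_) (.of_forall fun x => ?_)
  · rw [criticalError, norm_mul]
    refine mul_le_mul_of_nonneg_left ?_ (norm_nonneg _)
    have hin : |inner ℝ (B₂ x) (fderiv ℝ B₂ x (B₂ x))| ≤ M * ‖B₂ x‖ ^ 2 := by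
      refine (abs_real_inner_le_norm _ _).trans ?_
      calc ‖B₂ x‖ * ‖fderiv ℝ B₂ x (B₂ x)‖ ≤ ‖B₂ x‖ * (M * ‖B₂ x‖) := by
            gcongr
            exact ((fderiv ℝ B₂ x).le_opNorm _).trans (by gcongr; exact hM x)
        _ = M * ‖B₂ x‖ ^ 2 := by ring
    have hM0 : 0 ≤ M := (norm_nonneg _).trans (hM x)
    calc ‖(n : ℝ) * deriv smoothStep (n * ‖B₂ x‖ ^ 2) *
          (2 * inner ℝ (B₂ x) (fderiv ℝ B₂ x (B₂ x)))‖
        = n * |deriv smoothStep (n * ‖B₂ x‖ ^ 2)| *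
          (2 * |inner ℝ (B₂ x) (fderiv ℝ B₂ x (B₂ x))|) := by
          simp
      _ ≤ n * |deriv smoothStep (n * ‖B₂ x‖ ^ 2)| * (2 * (M * ‖B₂ x‖ ^ 2)) := by gcongr
      _ = |n * ‖B₂ x‖ ^ 2 * deriv smoothStep (n * ‖B₂ x‖ ^ 2)| * (2 * M) := by
          rw [abs_mul, abs_of_nonneg (by positivity : (0 : ℝ) ≤ n * ‖B₂ x‖ ^ 2)]
          ring
      _ ≤ C * (2 * M) := by gcongr; exact hC _
  · refine tendsto_const_nhds.congr' ?_
    by_cases hx : B₂ x = 0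
    · exact .of_forall fun n => by simp [criticalError, hx]
    · have hN : 0 < ‖B₂ x‖ ^ 2 := by positivity
      obtain ⟨N, hN'⟩ := exists_nat_gt (2 / ‖B₂ x‖ ^ 2)
      filter_upwards [eventually_ge_atTop N] with n hn
      have : 2 < (n : ℝ) * ‖B₂ x‖ ^ 2 := by
        rw [← div_lt_iff₀ hN]
        exact hN'.trans_le (by exact_mod_cast hn)
      simp [criticalError, deriv_smoothStep_of_two_lt this]

/-- The ratio `u₁ / u₂` may be unbounded, but multiplied by `‖B₂‖` it becomes `‖B₁‖`. -/
theorem softAbs_defect_mul_norm_le (h₁ : EllipticPotential c₂ l₀ l₁ H₁ u₁ B₁)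
    (h₂ : EllipticPotential c₂ l₀ l₁ H₂ u₂ B₂) (hB : ∀ x, u₂ x • B₁ x = u₁ x • B₂ x) (x : Rd d) :
    softAbs (defect H₁ H₂ u₁ u₂ x) * ‖B₂ x‖ ≤ H₁ x * ‖B₂ x‖ + H₂ x * ‖B₁ x‖ := by
  have hm : 0 ≤ u₁ x / u₂ x := (div_pos (h₁.source_pos x) (h₂.source_pos x)).le
  calc softAbs (defect H₁ H₂ u₁ u₂ x) * ‖B₂ x‖
      ≤ (H₁ x + u₁ x / u₂ x * H₂ x) * ‖B₂ x‖ := by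
        gcongr
        refine (softAbs_le_abs _).trans ((abs_sub _ _).trans_eq ?_)
        rw [abs_of_pos (h₁.pos x), abs_of_nonneg (mul_nonneg hm (h₂.pos x).le)]
    _ = H₁ x * ‖B₂ x‖ + H₂ x * ‖B₁ x‖ := by
        rw [h₂.eq_smul hB x, norm_smul, Real.norm_of_nonneg hm]
        ring

/-- The integrated energy inequality, localized to a measurable set on which `H₂` has no critical
points. -/
theorem measureReal_le_of_defect (h₁ : EllipticPotential c₂ l₀ l₁ H₁ u₁ B₁)
    (h₂ : EllipticPotential c₂ l₀ l₁ H₂ u₂ B₂) (hc₂ : 0 ≤ c₂) (hl₀ : 0 ≤ l₀) (hl₁ : 0 ≤ l₁)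
    (hB : ∀ x, u₂ x • B₁ x = u₁ x • B₂ x) {S : Set (Rd d)} (hS : MeasurableSet S)
    (hSfin : volume S ≠ ⊤) {a b : ℝ}
    (ha : ∀ x ∈ S, a ≤ softAbs (defect H₁ H₂ u₁ u₂ x) * u₂ x) (hb : 0 < b)
    (hb' : ∀ x ∈ S, b ≤ ‖B₂ x‖ ^ 2) {χ : Rd d → ℝ} (hχ : ContDiff ℝ 1 χ)
    (hc : HasCompactSupport χ) (h0 : ∀ x, 0 ≤ χ x) (h1 : ∀ x ∈ S, χ x = 1) {D : ℝ}
    (hD : ∀ x, ‖fderiv ℝ χ x‖ ≤ D)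
    (hi : Integrable fun x => H₁ x * ‖B₂ x‖ + H₂ x * ‖B₁ x‖) :
    c₂ * a * volume.real S ≤ l₁ * D * ∫ x, (H₁ x * ‖B₂ x‖ + H₂ x * ‖B₁ x‖) := by
  have hD0 : 0 ≤ D := (norm_nonneg _).trans (hD 0)
  have key : ∀ᶠ n : ℕ in atTop, c₂ * a * volume.real S ≤
      l₁ * (∫ x, criticalError H₁ H₂ u₁ u₂ B₂ χ n x)
      + l₁ * D * ∫ x, (H₁ x * ‖B₂ x‖ + H₂ x * ‖B₁ x‖) := by
    obtain ⟨N, hN⟩ := exists_nat_gt (2 / b)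
    filter_upwards [eventually_ge_atTop N] with n hn
    -- For such `n` the localization equals `1` on all of `S`.
    have hn' : 2 ≤ n * b := by
      rw [← div_le_iff₀ hb]
      exact hN.le.trans (by exact_mod_cast hn)
    set X := fun y => testFun H₁ H₂ u₁ u₂ B₂ χ n y • B₂ y with hX
    have hXd : ContDiff ℝ 1 X := (h₁.contDiff_testFun h₂ hB hχ n).smul h₂.contDiff
    have hXc : HasCompactSupport X := (hasCompactSupport_testFun hc n).smul_right
    have hdc : HasCompactSupport (divergence X) := by
      refine (hXc.fderiv ℝ).mono fun x hx => ?_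
      contrapose! hx
      simp only [Function.mem_support, not_not] at hx ⊢
      simp [divergence, hx]
    have hdi : Integrable (divergence X) :=
      (continuous_divergence hXd).integrable_of_hasCompactSupport hdc
    have hei : Integrable (criticalError H₁ H₂ u₁ u₂ B₂ χ n) :=
      (h₁.continuous_criticalError h₂ hχ.continuous n).integrable_of_hasCompactSupport
        (hasCompactSupport_criticalError hc n)
    -- Pointwise form of the energy inequality: the convexity term is dropped, the source term is
    -- kept only on `S`, and the spatial cutoff error is bounded by `D`.
    have hpt : ∀ x, S.indicator (fun _ => c₂ * a) x ≤ l₁ * criticalError H₁ H₂ u₁ u₂ B₂ χ n x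
        + l₁ * D * (H₁ x * ‖B₂ x‖ + H₂ x * ‖B₁ x‖) - l₁ * divergence X x := by
      intro x
      have hdiv := h₁.divergence_testFun_smul h₂ hB hχ n x
      have hψ0 : 0 ≤ smoothStep (n * ‖B₂ x‖ ^ 2) := Real.smoothTransition.nonneg _
      have hψ1 : smoothStep (n * ‖B₂ x‖ ^ 2) ≤ 1 := Real.smoothTransition.le_one _
      have hφ0 := softAbs_nonneg (defect H₁ H₂ u₁ u₂ x)
      have hcut : l₁ * (smoothStep (n * ‖B₂ x‖ ^ 2) * softAbs (defect H₁ H₂ u₁ u₂ x) *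
          fderiv ℝ χ x (B₂ x)) ≤ l₁ * D * (H₁ x * ‖B₂ x‖ + H₂ x * ‖B₁ x‖) := by
        rw [mul_assoc l₁ D]
        refine mul_le_mul_of_nonneg_left ?_ hl₁
        calc smoothStep (n * ‖B₂ x‖ ^ 2) * softAbs (defect H₁ H₂ u₁ u₂ x) * fderiv ℝ χ x (B₂ x)
            ≤ 1 * softAbs (defect H₁ H₂ u₁ u₂ x) * (D * ‖B₂ x‖) := by
              refine (mul_le_mul_of_nonneg_left ?_ (mul_nonneg hψ0 hφ0)).trans
                (mul_le_mul_of_nonneg_right (mul_le_mul_of_nonneg_right hψ1 hφ0)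
                  (mul_nonneg hD0 (norm_nonneg _)))
              exact (le_abs_self _).trans (((fderiv ℝ χ x).le_opNorm _).trans
                (mul_le_mul_of_nonneg_right (hD x) (norm_nonneg _)))
          _ = D * (softAbs (defect H₁ H₂ u₁ u₂ x) * ‖B₂ x‖) := by ring
          _ ≤ _ := mul_le_mul_of_nonneg_left (h₁.softAbs_defect_mul_norm_le h₂ hB x) hD0
      have hconv : 0 ≤ χ x * smoothStep (n * ‖B₂ x‖ ^ 2) * (l₀ * H₂ x *
          (defect H₁ H₂ u₁ u₂ x * deriv softAbs (defect H₁ H₂ u₁ u₂ x)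
            - softAbs (defect H₁ H₂ u₁ u₂ x))) :=
        mul_nonneg (mul_nonneg (h0 x) hψ0) (mul_nonneg (mul_nonneg hl₀ (h₂.pos x).le)
          (sub_nonneg.2 (softAbs_le_mul_deriv _)))
      have hind : S.indicator (fun _ => c₂ * a) x ≤
          c₂ * (testFun H₁ H₂ u₁ u₂ B₂ χ n x * u₂ x) := by
        by_cases hx : x ∈ S
        · rw [Set.indicator_of_mem hx, testFun, h1 x hx, smoothStep_of_two_le, one_mul, one_mul]
          · exact mul_le_mul_of_nonneg_left (ha x hx) hc₂
          · exact hn'.trans (mul_le_mul_of_nonneg_left (hb' x hx) n.cast_nonneg)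
        · rw [Set.indicator_of_notMem hx]
          exact mul_nonneg hc₂ (mul_nonneg (mul_nonneg (mul_nonneg (h0 x) hψ0) hφ0)
            (h₂.source_pos x).le)
      linarith
    have hsi : Integrable (S.indicator fun _ : Rd d => c₂ * a) :=
      (integrable_indicator_iff hS).2 (integrableOn_const hSfin)
    have := integral_mono hsi (((hei.const_mul l₁).add (hi.const_mul (l₁ * D))).sub
      (hdi.const_mul l₁)) hpt
    rw [integral_indicator_const _ hS, integral_sub' ((hei.const_mul l₁).add
      (hi.const_mul (l₁ * D))) (hdi.const_mul l₁), integral_add' (hei.const_mul l₁)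
      (hi.const_mul (l₁ * D)), integral_const_mul, integral_const_mul, integral_const_mul,
      integral_divergence_eq_zero_of_hasCompactSupport hXd hXc, smul_eq_mul, mul_zero,
      sub_zero] at this
    rwa [mul_comm (c₂ * a)]
  have lim := ((h₁.tendsto_integral_criticalError h₂ hχ.continuous hc).const_mul l₁).add_const
    (l₁ * D * ∫ x, (H₁ x * ‖B₂ x‖ + H₂ x * ‖B₁ x‖))
  rw [mul_zero, zero_add] at lim
  exact ge_of_tendsto lim key

theorem integrable_cross (h₁ : EllipticPotential c₂ l₀ l₁ H₁ u₁ B₁)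
    (h₂ : EllipticPotential c₂ l₀ l₁ H₂ u₂ B₂) : Integrable fun x => H₁ x * ‖B₂ x‖ := by
  obtain ⟨M, hM⟩ := h₁.bounded
  refine h₂.integrable.norm.bdd_mul h₁.continuous.aestronglyMeasurable (c := M)
    (.of_forall fun x => ?_)
  rw [Real.norm_of_nonneg (h₁.pos x).le]
  exact hM x

/-- If the defect were nonzero at `x`, a small closed ball about `x` would carry a fixed positive
amount of energy, while the right-hand side of the energy inequality is `O(1 / R)` for cutoffs at
scale `R`. -/
theorem defect_eq_zero_of_ne_zero (h₁ : EllipticPotential c₂ l₀ l₁ H₁ u₁ B₁)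
    (h₂ : EllipticPotential c₂ l₀ l₁ H₂ u₂ B₂) (hc₂ : 0 < c₂) (hl₀ : 0 ≤ l₀) (hl₁ : 0 ≤ l₁)
    (hB : ∀ x, u₂ x • B₁ x = u₁ x • B₂ x) {x : Rd d} (hx : B₂ x ≠ 0) :
    defect H₁ H₂ u₁ u₂ x = 0 := by
  by_contra hG
  have ha : 0 < softAbs (defect H₁ H₂ u₁ u₂ x) * u₂ x :=
    mul_pos (softAbs_pos hG) (h₂.source_pos x)
  have hb : 0 < ‖B₂ x‖ ^ 2 := by positivity
  have hac : Continuous fun y => softAbs (defect H₁ H₂ u₁ u₂ y) * u₂ y :=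
    (contDiff_softAbs.continuous.comp (h₁.continuous_defect h₂)).mul h₂.source_continuous
  have hbc : Continuous fun y => ‖B₂ y‖ ^ 2 := h₂.contDiff.continuous.norm.pow 2
  obtain ⟨r, hr, hball⟩ := Metric.nhds_basis_closedBall.mem_iff.1
    ((hac.continuousAt.eventually_const_lt (half_lt_self ha)).and
      (hbc.continuousAt.eventually_const_lt (half_lt_self hb)))
  obtain ⟨C, hC0, hC⟩ := exists_cutoff d
  have hi := (h₁.integrable_cross h₂).add (h₂.integrable_cross h₁)
  set K := ∫ x, (H₁ x * ‖B₂ x‖ + H₂ x * ‖B₁ x‖)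
  have hle : ∀ᶠ R : ℝ in atTop, c₂ * (softAbs (defect H₁ H₂ u₁ u₂ x) * u₂ x / 2) *
      volume.real (Metric.closedBall x r) ≤ l₁ * (C / R) * K := by
    -- From `R ≥ ‖x‖ + r` on, the cutoff is `1` on the whole ball.
    filter_upwards [eventually_gt_atTop 0, eventually_ge_atTop (‖x‖ + r)] with R hR hR'
    obtain ⟨χ, hχ, hcs, h01, hone, hder⟩ := hC R hR
    refine h₁.measureReal_le_of_defect h₂ hc₂.le hl₀ hl₁ hB measurableSet_closedBall
      measure_closedBall_lt_top.ne (fun y hy => (hball hy).1.le) (half_pos hb)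
      (fun y hy => (hball hy).2.le) hχ hcs (fun y => (h01 y).1) (fun y hy => hone y ?_) hder hi
    have h2 := norm_le_norm_add_norm_sub x y
    rw [Metric.mem_closedBall, dist_eq_norm] at hy
    rw [norm_sub_rev] at h2
    linarith
  have lim : Tendsto (fun R : ℝ => l₁ * (C / R) * K) atTop (𝓝 (l₁ * 0 * K)) :=
    ((tendsto_const_nhds.div_atTop tendsto_id).const_mul l₁).mul_const K
  have h3 := ge_of_tendsto lim hle
  have hvol : 0 < volume.real (Metric.closedBall x r) :=
    ENNReal.toReal_pos (Metric.measure_closedBall_pos volume x hr).ne'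
      measure_closedBall_lt_top.ne
  have : 0 < c₂ * (softAbs (defect H₁ H₂ u₁ u₂ x) * u₂ x / 2) *
      volume.real (Metric.closedBall x r) := by positivity
  rw [mul_zero, zero_mul] at h3
  linarith

/-- Two elliptic potentials whose gradients are proportional with ratio `u₁ / u₂` satisfy
`H₁ / H₂ = u₁ / u₂`. -/
theorem defect_eq_zero (h₁ : EllipticPotential c₂ l₀ l₁ H₁ u₁ B₁)
    (h₂ : EllipticPotential c₂ l₀ l₁ H₂ u₂ B₂) (hc₂ : 0 < c₂) (hl₀ : 0 < l₀) (hl₁ : 0 ≤ l₁)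
    (hB : ∀ x, u₂ x • B₁ x = u₁ x • B₂ x) (x : Rd d) : defect H₁ H₂ u₁ u₂ x = 0 := by
  -- Outside this closure `B₂` vanishes on a neighbourhood, so the two cases exhaust the space.
  by_cases hx : x ∈ closure {y | B₂ y ≠ 0}
  · exact closure_minimal (fun y hy => h₁.defect_eq_zero_of_ne_zero h₂ hc₂ hl₀.le hl₁ hB hy)
      (isClosed_eq (h₁.continuous_defect h₂) continuous_const) hx
  · refine h₁.defect_eq_zero_of_eventuallyEq_zero h₂ hl₀ hB ?_
    filter_upwards [isClosed_closure.isOpen_compl.mem_nhds hx] with y hy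
    by_contra hne
    exact hy (subset_closure hne)

/-- Two elliptic potentials whose gradients are proportional with ratio `u₁ / u₂` are
proportional. -/
theorem exists_eq_const_mul (h₁ : EllipticPotential c₂ l₀ l₁ H₁ u₁ B₁)
    (h₂ : EllipticPotential c₂ l₀ l₁ H₂ u₂ B₂) (hc₂ : 0 < c₂) (hl₀ : 0 < l₀) (hl₁ : 0 ≤ l₁)
    (hB : ∀ x, u₂ x • B₁ x = u₁ x • B₂ x) : ∃ k : ℝ, ∀ x, H₁ x = k * H₂ x := by
  have hd : ∀ x, HasFDerivAt (fun y => H₁ y * (H₂ y)⁻¹) (0 : Rd d →L[ℝ] ℝ) x := by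
    intro x
    have hH := (h₂.pos x).ne'
    have h := (h₁.hasFDerivAt x).mul ((hasDerivAt_inv hH).comp_hasFDerivAt x (h₂.hasFDerivAt x))
    have hz := h₁.defect_eq_zero h₂ hc₂ hl₀ hl₁ hB x
    rw [defect, sub_eq_zero] at hz
    refine h.congr_fderiv ?_
    ext v
    simp only [h₂.eq_smul hB x, hz, smul_apply, add_apply, innerSL_apply_apply, zero_apply,
      smul_eq_mul, real_inner_smul_left, Function.comp_apply]
    field_simp
    ring
  refine ⟨H₁ 0 * (H₂ 0)⁻¹, fun x => ?_⟩
  have : H₁ 0 * (H₂ 0)⁻¹ = H₁ x * (H₂ x)⁻¹ :=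
    is_const_of_fderiv_eq_zero (𝕜 := ℝ) (fun x => (hd x).differentiableAt)
      (fun x => (hd x).fderiv) 0 x
  rw [this, inv_mul_cancel_right₀ (h₂.pos x).ne']

end EllipticPotential

/-! ### Convolution of a function with a probability measure -/

/-- The convolution `(f * r) x = ∫ f (x - y) r(dy)`. -/
noncomputable def smear {d : ℕ} {F : Type*} [NormedAddCommGroup F] [NormedSpace ℝ F]
    (r : Measure (Rd d)) (f : Rd d → F) (x : Rd d) : F := ∫ y, f (x - y) ∂r

/-- A continuous essentially bounded function is bounded. -/
theorem Continuous.exists_norm_le_of_memLp_top {d : ℕ} {F : Type*} [NormedAddCommGroup F]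
    {f : Rd d → F} (hf : Continuous f) (h : MemLp f ⊤ volume) : ∃ C, ∀ x, ‖f x‖ ≤ C := by
  refine ⟨(eLpNorm f ⊤ volume).toReal, fun x => ?_⟩
  have hae : ∀ᵐ x ∂(volume : Measure (Rd d)), ‖f x‖ ≤ (eLpNorm f ⊤ volume).toReal := by
    filter_upwards [enorm_ae_le_eLpNormEssSup f volume] with x hx
    rw [← toReal_enorm]
    exact ENNReal.toReal_mono h.eLpNorm_ne_top (by rwa [eLpNorm_exponent_top])
  -- A set of full Lebesgue measure is dense, and by continuity the bound holds on a closed set.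
  have hd := Measure.dense_of_ae hae
  have hc : IsClosed {x | ‖f x‖ ≤ (eLpNorm f ⊤ volume).toReal} :=
    isClosed_le hf.norm continuous_const
  have : x ∈ closure {x | ‖f x‖ ≤ (eLpNorm f ⊤ volume).toReal} := hd x
  rwa [hc.closure_eq] at this

section Smear

variable {d : ℕ} {F : Type*} [NormedAddCommGroup F] [NormedSpace ℝ F]
  {r : Measure (Rd d)} {f : Rd d → F} {C : ℝ}

omit [NormedSpace ℝ F] in
theorem Continuous.integrable_comp_sub [IsFiniteMeasure r] (hf : Continuous f)
    (hC : ∀ x, ‖f x‖ ≤ C) (x : Rd d) : Integrable (fun y => f (x - y)) r :=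
  (integrable_const C).mono' (hf.comp (continuous_sub_left x)).aestronglyMeasurable
    (.of_forall fun _ => hC _)

theorem norm_smear_le [IsProbabilityMeasure r] (hC : ∀ x, ‖f x‖ ≤ C) (x : Rd d) :
    ‖smear r f x‖ ≤ C := by
  simpa [smear] using norm_integral_le_of_norm_le_const (μ := r) (f := fun y => f (x - y))
    (.of_forall fun _ => hC _)

theorem continuous_smear [IsFiniteMeasure r] (hf : Continuous f) (hC : ∀ x, ‖f x‖ ≤ C) :
    Continuous (smear r f) :=
  continuous_of_dominated (bound := fun _ => C)
    (fun x => (hf.comp (continuous_sub_left x)).aestronglyMeasurable)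
    (fun _ => .of_forall fun _ => hC _) (integrable_const C)
    (.of_forall fun y => hf.comp (continuous_sub_right y))

theorem hasFDerivAt_smear [IsFiniteMeasure r] (hf : ContDiff ℝ 1 f) (hC : ∀ x, ‖f x‖ ≤ C)
    {C' : ℝ} (hC' : ∀ x, ‖fderiv ℝ f x‖ ≤ C') (x : Rd d) :
    HasFDerivAt (smear r f) (smear r (fderiv ℝ f) x) x := by
  refine hasFDerivAt_integral_of_dominated_of_fderiv_le (bound := fun _ => C')
    (F := fun x y => f (x - y)) (F' := fun x y => fderiv ℝ f (x - y)) univ_mem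
    (.of_forall fun x => (hf.continuous.integrable_comp_sub hC x).aestronglyMeasurable)
    (hf.continuous.integrable_comp_sub hC x)
    ((hf.continuous_fderiv one_ne_zero).integrable_comp_sub hC' x).aestronglyMeasurable
    (.of_forall fun _ _ _ => hC' _) (integrable_const C') (.of_forall fun y x _ => ?_)
  exact ((hf.differentiable one_ne_zero (x - y)).hasFDerivAt).comp x
    ((hasFDerivAt_id x).sub_const y)

theorem contDiff_smear [IsFiniteMeasure r] (hf : ContDiff ℝ 1 f) (hC : ∀ x, ‖f x‖ ≤ C)
    {C' : ℝ} (hC' : ∀ x, ‖fderiv ℝ f x‖ ≤ C') : ContDiff ℝ 1 (smear r f) :=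
  contDiff_one_iff_hasFDerivAt.2 ⟨_, continuous_smear (hf.continuous_fderiv one_ne_zero) hC',
    hasFDerivAt_smear hf hC hC'⟩

theorem MeasureTheory.Integrable.comp_sub_prod [IsFiniteMeasure r] (hf : Integrable f) :
    Integrable (fun z : Rd d × Rd d => f (z.1 - z.2)) (volume.prod r) := by
  -- The integrand is that of a convolution of `f` with the constant `1` taken with respect to `r`.
  simpa using (integrable_const (1 : ℝ) (μ := r)).convolution_integrand
    (ContinuousLinearMap.lsmul ℝ ℝ) hf

theorem integrable_smear [IsFiniteMeasure r] (hf : Integrable f) : Integrable (smear r f) :=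
  hf.comp_sub_prod.integral_prod_left

theorem smear_pos [IsProbabilityMeasure r] {f : Rd d → ℝ} (hf : Continuous f)
    (hC : ∀ x, ‖f x‖ ≤ C) (hpos : ∀ x, 0 < f x) (x : Rd d) : 0 < smear r f x := by
  refine (integral_pos_iff_support_of_nonneg (fun y => (hpos _).le)
    (hf.integrable_comp_sub hC x)).2 ?_
  have : (Function.support fun y => f (x - y)) = Set.univ := by
    ext y
    simp [(hpos _).ne']
  simp [this]

theorem divergence_smear [IsFiniteMeasure r] {X : Rd d → Rd d} (hX : ContDiff ℝ 1 X)
    (hC : ∀ x, ‖X x‖ ≤ C) {C' : ℝ} (hC' : ∀ x, ‖fderiv ℝ X x‖ ≤ C') (x : Rd d) :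
    divergence (smear r X) x = smear r (divergence X) x := by
  have hi := (hX.continuous_fderiv one_ne_zero).integrable_comp_sub (r := r) hC' x
  have hs : fderiv ℝ (smear r X) x = ∫ y, fderiv ℝ X (x - y) ∂r :=
    (hasFDerivAt_smear hX hC hC' x).fderiv
  have hi' : ∀ v, Integrable (fun y => fderiv ℝ X (x - y) v) r :=
    fun v => hi.apply_continuousLinearMap v
  have hsum := integral_finsetSum (μ := r) Finset.univ
    (f := fun i y => (fderiv ℝ X (x - y) (EuclideanSpace.single i 1)) i)
    fun i _ => (EuclideanSpace.proj (𝕜 := ℝ) i).integrable_comp (hi' (EuclideanSpace.single i 1))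
  rw [smear]
  refine Eq.trans (Finset.sum_congr rfl fun i _ => ?_) hsum.symm
  rw [hs, ContinuousLinearMap.integral_apply hi]
  exact ((EuclideanSpace.proj (𝕜 := ℝ) i).integral_comp_comm (hi' _)).symm

/-- The Fourier transform of `f * r` is the product of the Fourier transforms. -/
theorem integral_smear_mul_cexp [IsFiniteMeasure r] {f : Rd d → ℝ} (hf : Integrable f)
    (t : Rd d) :
    ∫ x, ((smear r f x : ℝ) : ℂ) * Complex.exp (inner ℝ x t * Complex.I) =
      (∫ x, (f x : ℂ) * Complex.exp (inner ℝ x t * Complex.I)) * charFun r t := by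
  have hcont : Continuous fun x : Rd d => Complex.exp (inner ℝ x t * Complex.I) := by fun_prop
  have hi : Integrable (Function.uncurry fun x y : Rd d =>
      (f (x - y) : ℂ) * Complex.exp (inner ℝ x t * Complex.I)) (volume.prod r) := by
    change Integrable (fun z : Rd d × Rd d =>
      (f (z.1 - z.2) : ℂ) * Complex.exp (inner ℝ z.1 t * Complex.I)) (volume.prod r)
    refine hf.comp_sub_prod.ofReal.mul_bdd (c := 1)
      (hcont.comp continuous_fst).aestronglyMeasurable (.of_forall fun z => ?_)
    simp [Complex.norm_exp_ofReal_mul_I]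
  calc ∫ x, ((smear r f x : ℝ) : ℂ) * Complex.exp (inner ℝ x t * Complex.I)
      = ∫ x, ∫ y, (f (x - y) : ℂ) * Complex.exp (inner ℝ x t * Complex.I) ∂r := by
        refine integral_congr_ae (.of_forall fun x => ?_)
        simp only [smear]
        rw [integral_mul_const, integral_complex_ofReal]
    _ = ∫ y, (∫ x, (f (x - y) : ℂ) * Complex.exp (inner ℝ x t * Complex.I)) ∂r :=
        integral_integral_swap hi
    _ = ∫ y, (∫ x, (f x : ℂ) * Complex.exp (inner ℝ x t * Complex.I)) *
          Complex.exp (inner ℝ y t * Complex.I) ∂r := by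
        refine integral_congr_ae (.of_forall fun y => ?_)
        simp only
        rw [← integral_mul_const, ← integral_add_right_eq_self _ y]
        refine integral_congr_ae (.of_forall fun x => ?_)
        simp only [add_sub_cancel_right, inner_add_left, Complex.ofReal_add, add_mul,
          Complex.exp_add, mul_assoc]
    _ = _ := by rw [integral_const_mul, charFun_apply]

end Smear

/-! ### Companions and their smoothings -/

namespace IsCompanion

variable {d : ℕ} {κ η : Rd d → ℝ} {c₁ c₂ l₀ l₁ : ℝ}

theorem fderiv_eq (η : Rd d → ℝ) (x : Rd d) : fderiv ℝ η x = innerSL ℝ (∇ η x) := by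
  ext v
  simp [inner_gradient_left]

theorem contDiff_gradient (h : IsCompanion κ η c₁ c₂ l₀ l₁) : ContDiff ℝ 1 (∇ η) := by
  refine contDiff_euclidean.2 fun i => ?_
  have : (fun x => ∇ η x i) = fun x => fderiv ℝ η x (EuclideanSpace.single i 1) := by
    funext x
    rw [← inner_gradient_left, EuclideanSpace.inner_single_right]
    simp
  rw [this]
  exact (h.contDiff.fderiv_right (m := 1) (by norm_num)).clm_apply contDiff_const

theorem contDiff_one (h : IsCompanion κ η c₁ c₂ l₀ l₁) : ContDiff ℝ 1 η :=
  h.contDiff.of_le (by norm_num)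

/-- Obtained by differentiating `⟪∇η, w⟫ = dη(w)`. It carries both the trace and the bound of the
Hessian over to the derivative of the gradient field. -/
theorem inner_fderiv_gradient (h : IsCompanion κ η c₁ c₂ l₀ l₁) (x v w : Rd d) :
    inner ℝ (fderiv ℝ (∇ η) x v) w = fderiv ℝ (fderiv ℝ η) x v w := by
  have hd : HasFDerivAt (fderiv ℝ η) (fderiv ℝ (fderiv ℝ η) x) x :=
    ((h.contDiff.fderiv_right (m := 1) (by norm_num)).differentiable one_ne_zero x).hasFDerivAt
  have h1 : HasFDerivAt (fun y => inner ℝ (∇ η y) w) _ x :=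
    ((h.contDiff_gradient.differentiable one_ne_zero x).hasFDerivAt).inner ℝ
      (hasFDerivAt_const w x)
  have h2 := hd.clm_apply (hasFDerivAt_const w x)
  simp only [inner_gradient_left] at h1
  have := congrArg (fun L => L v) (h1.unique h2)
  simpa using this

theorem divergence_gradient (h : IsCompanion κ η c₁ c₂ l₀ l₁) : divergence (∇ η) = Δ η := by
  rw [InnerProductSpace.laplacian_eq_iteratedFDeriv_orthonormalBasis η
    (EuclideanSpace.basisFun (Fin d) ℝ)]
  funext x
  refine Finset.sum_congr rfl fun i _ => ?_
  rw [iteratedFDeriv_two_apply]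
  have := h.inner_fderiv_gradient x (EuclideanSpace.single i 1) (EuclideanSpace.single i 1)
  simpa [EuclideanSpace.inner_single_right] using this

theorem exists_fderiv_gradient_le (h : IsCompanion κ η c₁ c₂ l₀ l₁) :
    ∃ C, ∀ x, ‖fderiv ℝ (∇ η) x‖ ≤ C := by
  obtain ⟨C, hC⟩ := (h.contDiff.continuous_iteratedFDeriv le_rfl).exists_norm_le_of_memLp_top
    h.hessian_memLp_top
  have h2 : ∀ x, ‖fderiv ℝ (fderiv ℝ η) x‖ ≤ C := fun x => by
    rw [← norm_iteratedFDeriv_one, norm_iteratedFDeriv_fderiv]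
    exact hC x
  refine ⟨C, fun x => ContinuousLinearMap.opNorm_le_bound _ ((norm_nonneg _).trans (hC x))
    fun v => ?_⟩
  rcases (norm_nonneg (fderiv ℝ (∇ η) x v)).eq_or_lt with h0 | h0
  · rw [← h0]
    exact mul_nonneg ((norm_nonneg _).trans (hC x)) (norm_nonneg _)
  -- The Hessian is tested on `v` and on the vector `fderiv ℝ (∇ η) x v` itself.
  · refine le_of_mul_le_mul_right ?_ h0
    rw [← real_inner_self_eq_norm_mul_norm, h.inner_fderiv_gradient]
    refine (le_abs_self _).trans (((fderiv ℝ (fderiv ℝ η) x v).le_opNorm _).trans ?_)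
    gcongr
    exact ((fderiv ℝ (fderiv ℝ η) x).le_opNorm v).trans (by gcongr; exact h2 x)

theorem ellipticPotential (h : IsCompanion κ η c₁ c₂ l₀ l₁) (hpos : ∀ z, 0 < κ z)
    (hκ : Continuous κ) (hb : MemLp κ ⊤ volume) (r : Measure (Rd d)) [IsProbabilityMeasure r] :
    EllipticPotential c₂ l₀ l₁ (smear r η) (smear r κ) (smear r (∇ η)) := by
  obtain ⟨Cκ, hCκ⟩ := hκ.exists_norm_le_of_memLp_top hb
  have hη := h.contDiff.continuous
  have hg := h.contDiff_gradient
  obtain ⟨Cη, hCη⟩ := hη.exists_norm_le_of_memLp_top h.memLp_top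
  obtain ⟨Cg, hCg⟩ := hg.continuous.exists_norm_le_of_memLp_top h.gradient_memLp_top
  obtain ⟨C, hC⟩ := h.exists_fderiv_gradient_le
  have hCd : ∀ x, ‖fderiv ℝ η x‖ ≤ Cg := fun x => by
    rw [fderiv_eq, innerSL_apply_norm]
    exact hCg x
  refine ⟨fun x => ?_, contDiff_smear hg hCg hC, smear_pos hη hCη h.pos, smear_pos hκ hCκ hpos,
    continuous_smear hκ hCκ, fun x => ?_, ⟨Cη, fun x => (le_abs_self _).trans
      (norm_smear_le hCη x)⟩, ⟨C, fun x => ?_⟩, integrable_smear h.gradient_integrable⟩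
  · refine (hasFDerivAt_smear (r := r) h.contDiff_one hCη hCd x).congr_fderiv ?_
    simp only [smear, fderiv_eq]
    exact (innerSL ℝ).integral_comp_comm (hg.continuous.integrable_comp_sub (r := r) hCg x)
  · rw [divergence_smear hg hCg hC, h.divergence_gradient]
    simp only [smear]
    have hκi := hκ.integrable_comp_sub (r := r) hCκ x
    have hηi := hη.integrable_comp_sub (r := r) hCη x
    rw [← integral_const_mul, ← integral_const_mul, ← integral_const_mul,
      ← integral_sub (hηi.const_mul l₀)]
    · simp only [h.elliptic_eq]
    · refine ((hηi.const_mul l₀).sub (hκi.const_mul c₂)).congr (.of_forall fun y => ?_)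
      simp [← h.elliptic_eq]
  · rw [(hasFDerivAt_smear hg hCg hC x).fderiv]
    exact norm_smear_le hC x

theorem smul_sub_eq (h : IsCompanion κ η c₁ c₂ l₀ l₁) (x y : Rd d) :
    κ (x - y) • (y - x) = c₁ • ∇ η (x - y) := by
  rw [h.gradient_eq, smul_neg, smul_smul, mul_div_cancel₀ _ h.c₁_pos.ne', ← smul_neg, neg_sub]

theorem centeredMoment_eq (h : IsCompanion κ η c₁ c₂ l₀ l₁) (r : Measure (Rd d)) (x : Rd d) :
    centeredMoment κ r x = c₁ • smear r (∇ η) x := by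
  simp only [centeredMoment, smear, h.smul_sub_eq, integral_smul]

theorem barycenterDomain_eq_univ (h : IsCompanion κ η c₁ c₂ l₀ l₁) (hpos : ∀ z, 0 < κ z)
    (hκ : Continuous κ) (hb : MemLp κ ⊤ volume) (r : Measure (Rd d)) [IsProbabilityMeasure r] :
    barycenterDomain κ r = Set.univ := by
  obtain ⟨Cκ, hCκ⟩ := hκ.exists_norm_le_of_memLp_top hb
  have hg := h.contDiff_gradient.continuous
  obtain ⟨Cg, hCg⟩ := hg.exists_norm_le_of_memLp_top h.gradient_memLp_top
  refine Set.eq_univ_of_forall fun x => ⟨(hκ.integrable_comp_sub hCκ x).lintegral_lt_top, ?_⟩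
  refine Integrable.lintegral_lt_top
    (((hg.integrable_comp_sub hCg x).norm.const_mul c₁).congr (.of_forall fun y => ?_))
  have := congrArg norm (h.smul_sub_eq x y)
  rw [norm_smul, norm_smul, Real.norm_of_nonneg (hpos _).le,
    Real.norm_of_nonneg h.c₁_pos.le] at this
  simp only [← this, mul_comm]

end IsCompanion

theorem kernelMass_toReal {d : ℕ} {κ : Rd d → ℝ} (hpos : ∀ z, 0 < κ z) (hκ : Continuous κ)
    (r : Measure (Rd d)) (x : Rd d) : (kernelMass κ r x).toReal = smear r κ x :=
  (integral_eq_lintegral_of_nonneg_ae (.of_forall fun _ => (hpos _).le)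
    (hκ.comp (continuous_sub_left x)).aestronglyMeasurable).symm

/-! ### The cosine transform of a companion is positive -/

theorem hasFDerivAt_mul_inner {d : ℕ} (s : ℝ) (t x : Rd d) :
    HasFDerivAt (fun y => s * inner ℝ y t) (s • innerSL ℝ t) x := by
  have : (fun y : Rd d => s * inner ℝ y t) = fun y => (s • innerSL ℝ t) y := by
    funext y
    simp [real_inner_comm]
  rw [this]
  exact (s • innerSL ℝ t).hasFDerivAt

theorem MeasureTheory.Integrable.mul_of_abs_le_one {d : ℕ} {f g : Rd d → ℝ} (hf : Integrable f)
    (hg : Continuous g) (h : ∀ x, |g x| ≤ 1) : Integrable fun x => f x * g x :=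
  hf.mul_bdd (c := 1) hg.aestronglyMeasurable (.of_forall h)

theorem divergence_const {d : ℕ} (v x : Rd d) : divergence (fun _ => v) x = 0 := by
  simp [divergence]

namespace IsCompanion

variable {d : ℕ} {κ η : Rd d → ℝ} {c₁ c₂ l₀ l₁ : ℝ}

theorem integrable_inner_gradient (h : IsCompanion κ η c₁ c₂ l₀ l₁) (t : Rd d) :
    Integrable fun x => inner ℝ (∇ η x) t :=
  h.gradient_integrable.inner_const t

/-- The field `η sin(s⟪x, t⟫) t` has total divergence zero. -/
theorem integral_inner_gradient_mul_sin (h : IsCompanion κ η c₁ c₂ l₀ l₁) (t : Rd d) (s : ℝ) :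
    ∫ x, inner ℝ (∇ η x) t * Real.sin (s * inner ℝ x t) =
      -(s * ‖t‖ ^ 2 * ∫ x, η x * Real.cos (s * inner ℝ x t)) := by
  have hsin : ContDiff ℝ 1 fun x : Rd d => Real.sin (s * inner ℝ x t) :=
    Real.contDiff_sin.comp (contDiff_const.mul (contDiff_id.inner ℝ contDiff_const))
  have hcos : Continuous fun x : Rd d => Real.cos (s * inner ℝ x t) := by fun_prop
  have hf : ContDiff ℝ 1 fun x => η x * Real.sin (s * inner ℝ x t) := h.contDiff_one.mul hsin
  have i1 := (h.integrable_inner_gradient t).mul_of_abs_le_one hsin.continuous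
    fun x => Real.abs_sin_le_one _
  have i2 := h.integrable.mul_of_abs_le_one hcos fun x => Real.abs_cos_le_one _
  have hdiv : divergence (fun x => (η x * Real.sin (s * inner ℝ x t)) • t) = fun x =>
      inner ℝ (∇ η x) t * Real.sin (s * inner ℝ x t)
        + s * ‖t‖ ^ 2 * (η x * Real.cos (s * inner ℝ x t)) := by
    funext x
    have hd : HasFDerivAt (fun x => η x * Real.sin (s * inner ℝ x t)) _ x :=
      (h.contDiff_one.differentiable one_ne_zero x).hasFDerivAt.mul
        ((Real.hasDerivAt_sin _).comp_hasFDerivAt x (hasFDerivAt_mul_inner s t x))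
    rw [divergence_smul (hf.differentiable one_ne_zero x) (differentiableAt_const t),
      divergence_const, hd.fderiv]
    simp only [add_apply, smul_apply, innerSL_apply_apply, smul_eq_mul,
      fderiv_eq, real_inner_self_eq_norm_sq]
    ring
  have := integral_divergence_eq_zero
    (X := fun x => (η x * Real.sin (s * inner ℝ x t)) • t) (hf.smul contDiff_const)
    ((h.integrable.mul_of_abs_le_one hsin.continuous fun x => Real.abs_sin_le_one _).smul_const t)
    (by rw [hdiv]; exact i1.add (i2.const_mul _))
  rw [hdiv, integral_add i1 (i2.const_mul _), integral_const_mul] at this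
  linarith

/-- The field `cos(s⟪x, t⟫) ∇η` has total divergence zero. -/
theorem integral_laplacian_mul_cos (h : IsCompanion κ η c₁ c₂ l₀ l₁) (hΔ : Integrable (Δ η))
    (t : Rd d) (s : ℝ) :
    ∫ x, (Δ η) x * Real.cos (s * inner ℝ x t) =
      s * ∫ x, inner ℝ (∇ η x) t * Real.sin (s * inner ℝ x t) := by
  have hsin : Continuous fun x : Rd d => Real.sin (s * inner ℝ x t) := by fun_prop
  have hcos : ContDiff ℝ 1 fun x : Rd d => Real.cos (s * inner ℝ x t) :=
    Real.contDiff_cos.comp (contDiff_const.mul (contDiff_id.inner ℝ contDiff_const))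
  have i1 := (h.integrable_inner_gradient t).mul_of_abs_le_one hsin
    fun x => Real.abs_sin_le_one _
  have i2 := hΔ.mul_of_abs_le_one hcos.continuous fun x => Real.abs_cos_le_one _
  have hdiv : divergence (fun x => Real.cos (s * inner ℝ x t) • ∇ η x) = fun x =>
      (Δ η) x * Real.cos (s * inner ℝ x t)
        - s * (inner ℝ (∇ η x) t * Real.sin (s * inner ℝ x t)) := by
    funext x
    have hd : HasFDerivAt (fun x => Real.cos (s * inner ℝ x t)) _ x :=
      (Real.hasDerivAt_cos _).comp_hasFDerivAt x (hasFDerivAt_mul_inner s t x)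
    rw [divergence_smul (hcos.differentiable one_ne_zero x)
      (h.contDiff_gradient.differentiable one_ne_zero x), h.divergence_gradient, hd.fderiv]
    simp only [smul_apply, innerSL_apply_apply, smul_eq_mul, real_inner_comm]
    ring
  have hX : Integrable fun x => Real.cos (s * inner ℝ x t) • ∇ η x :=
    h.gradient_integrable.bdd_smul 1 hcos.continuous.aestronglyMeasurable
      (.of_forall fun x => Real.abs_cos_le_one _)
  have := integral_divergence_eq_zero (X := fun x => Real.cos (s * inner ℝ x t) • ∇ η x)
    (hcos.smul h.contDiff_gradient) hX
    (by rw [hdiv]; exact i2.sub (i1.const_mul _))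
  rw [hdiv, integral_sub i2 (i1.const_mul _), integral_const_mul] at this
  linarith

theorem cos_transform_eq (h : IsCompanion κ η c₁ c₂ l₀ l₁) (hκ : Integrable κ)
    (t : Rd d) (s : ℝ) :
    (l₀ + l₁ * (s ^ 2 * ‖t‖ ^ 2)) * ∫ x, η x * Real.cos (s * inner ℝ x t) =
      c₂ * ∫ x, κ x * Real.cos (s * inner ℝ x t) := by
  have hcos : Continuous fun x : Rd d => Real.cos (s * inner ℝ x t) := by fun_prop
  have iη := h.integrable.mul_of_abs_le_one hcos fun x => Real.abs_cos_le_one _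
  have iκ := hκ.mul_of_abs_le_one hcos fun x => Real.abs_cos_le_one _
  have key : l₁ * ∫ x, (Δ η) x * Real.cos (s * inner ℝ x t) =
      l₀ * (∫ x, η x * Real.cos (s * inner ℝ x t)) -
        c₂ * ∫ x, κ x * Real.cos (s * inner ℝ x t) := by
    rw [← integral_const_mul, ← integral_const_mul, ← integral_const_mul,
      ← integral_sub (iη.const_mul _) (iκ.const_mul _)]
    refine integral_congr_ae (.of_forall fun x => ?_)
    simp only
    linear_combination Real.cos (s * inner ℝ x t) * -h.elliptic_eq x
  -- If `l₁ = 0` the Laplacian drops out; if `l₁ > 0` its integrability follows by solving the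
  -- elliptic equation for `Δ η`.
  rcases h.l₁_nonneg.eq_or_lt with h0 | h0
  · rw [← h0] at key ⊢
    linarith
  · have hΔ : Integrable (Δ η) := by
      refine (((h.integrable.const_mul l₀).sub (hκ.const_mul c₂)).const_mul l₁⁻¹).congr
        (.of_forall fun x => ?_)
      simp only [Pi.sub_apply]
      rw [← h.elliptic_eq]
      field_simp
      ring
    rw [h.integral_laplacian_mul_cos hΔ, h.integral_inner_gradient_mul_sin] at key
    linarith

/-- Differentiation brings down `⟪x, t⟫ κ`, which is `-c₁ ⟪∇η, t⟫`: integrable, and one integration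
by parts away from the transform of `η`. -/
theorem hasDerivAt_cos_transform (h : IsCompanion κ η c₁ c₂ l₀ l₁) (hκ : Integrable κ)
    (t : Rd d) (s : ℝ) :
    HasDerivAt (fun s : ℝ => ∫ x, κ x * Real.cos (s * inner ℝ x t))
      (-(c₁ * (s * ‖t‖ ^ 2 * ∫ x, η x * Real.cos (s * inner ℝ x t)))) s := by
  have hκt : ∀ x, κ x * inner ℝ x t = -(c₁ * inner ℝ (∇ η x) t) := fun x => by
    rw [h.gradient_eq, inner_neg_left, real_inner_smul_left]
    have := h.c₁_pos.ne'
    field_simp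
  have hcos : ∀ s, Continuous fun x : Rd d => Real.cos (s * inner ℝ x t) := by fun_prop
  have hsin : ∀ s, Continuous fun x : Rd d => Real.sin (s * inner ℝ x t) := by fun_prop
  have := (hasDerivAt_integral_of_dominated_loc_of_deriv_le (μ := (volume : Measure (Rd d)))
    (F := fun s x => κ x * Real.cos (s * inner ℝ x t))
    (F' := fun s x => c₁ * (inner ℝ (∇ η x) t * Real.sin (s * inner ℝ x t)))
    (bound := fun x => ‖c₁ * inner ℝ (∇ η x) t‖) (x₀ := s) univ_mem
    (.of_forall fun s => (hκ.mul_of_abs_le_one (hcos s)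
      fun x => Real.abs_cos_le_one _).aestronglyMeasurable)
    (hκ.mul_of_abs_le_one (hcos s) fun x => Real.abs_cos_le_one _)
    (((h.integrable_inner_gradient t).mul_of_abs_le_one (hsin s)
      fun x => Real.abs_sin_le_one _).const_mul c₁).aestronglyMeasurable
    (.of_forall fun x s _ => ?_) ((h.integrable_inner_gradient t).const_mul c₁).norm
    (.of_forall fun x s _ => ?_)).2
  · rw [integral_const_mul, h.integral_inner_gradient_mul_sin] at this
    exact this.congr_deriv (by ring)
  · rw [← mul_assoc, norm_mul]
    exact mul_le_of_le_one_right (norm_nonneg _) (Real.abs_sin_le_one _)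
  · have h1 := (((hasDerivAt_id s).mul_const (inner ℝ x t)).cos).const_mul (κ x)
    refine h1.congr_deriv ?_
    simp only [id_eq, one_mul]
    linear_combination -Real.sin (s * inner ℝ x t) * hκt x

/-- Eliminating the transform of `η` between the elliptic and gradient relations gives `K' = -a K`
for the transform `K` of `κ`, with `a` continuous. As `K 0 = ∫ κ > 0`, `K` stays positive, and the
transform of `η` is a positive multiple of it. -/
theorem cos_transform_pos (h : IsCompanion κ η c₁ c₂ l₀ l₁) (hκ : Integrable κ)
    (hpos : ∀ z, 0 < κ z) (t : Rd d) : 0 < ∫ x, η x * Real.cos (inner ℝ x t) := by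
  set K := fun s : ℝ => ∫ x, κ x * Real.cos (s * inner ℝ x t) with hK
  have hden : ∀ s : ℝ, 0 < l₀ + l₁ * (s ^ 2 * ‖t‖ ^ 2) := fun s =>
    add_pos_of_pos_of_nonneg h.l₀_pos (mul_nonneg h.l₁_nonneg (by positivity))
  have hE : ∀ s, ∫ x, η x * Real.cos (s * inner ℝ x t) =
      c₂ * K s / (l₀ + l₁ * (s ^ 2 * ‖t‖ ^ 2)) := fun s => by
    rw [eq_div_iff (hden s).ne', mul_comm, h.cos_transform_eq hκ]
  set a := fun s : ℝ => c₁ * (s * ‖t‖ ^ 2 * (c₂ / (l₀ + l₁ * (s ^ 2 * ‖t‖ ^ 2)))) with ha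
  have hac : Continuous a := by
    refine continuous_const.mul ((by fun_prop : Continuous fun s : ℝ => s * ‖t‖ ^ 2).mul
      (continuous_const.div (by fun_prop) fun s => (hden s).ne'))
  have hKd : ∀ s, HasDerivAt K (-(a s * K s)) s := fun s => by
    refine (h.hasDerivAt_cos_transform hκ t s).congr_deriv ?_
    rw [hE]
    ring
  have hAd : ∀ s, HasDerivAt (fun s => ∫ τ in (0 : ℝ)..s, a τ) (a s) s := fun s =>
    intervalIntegral.integral_hasDerivAt_right (hac.intervalIntegrable _ _)
      (hac.stronglyMeasurableAtFilter _ _) hac.continuousAt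
  -- Integrating factor for `K' = -a K`.
  have hconst : ∀ s, HasDerivAt (fun s => K s * Real.exp (∫ τ in (0 : ℝ)..s, a τ)) 0 s :=
    fun s => ((hKd s).mul (hAd s).exp).congr_deriv (by ring)
  have heq := is_const_of_deriv_eq_zero (fun s => (hconst s).differentiableAt)
    (fun s => (hconst s).deriv) 1 0
  have hK0 : 0 < K 0 := by
    simp only [hK, zero_mul, Real.cos_zero, mul_one]
    refine (integral_pos_iff_support_of_nonneg (fun x => (hpos x).le) hκ).2 ?_
    have : Function.support κ = Set.univ := by
      ext y
      simp [(hpos y).ne']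
    rw [this]
    exact isOpen_univ.measure_pos volume Set.univ_nonempty
  have hK1 : 0 < K 1 := by
    simp only [intervalIntegral.integral_same, Real.exp_zero, mul_one] at heq
    exact pos_of_mul_pos_left (heq ▸ hK0) (Real.exp_pos _).le
  have := hE 1
  simp only [one_mul] at this
  rw [this]
  exact div_pos (mul_pos h.c₂_pos hK1) (by simpa using hden 1)

/-- The real part is the cosine transform, which is positive. -/
theorem fourier_ne_zero (h : IsCompanion κ η c₁ c₂ l₀ l₁) (hκ : Integrable κ)
    (hpos : ∀ z, 0 < κ z) (t : Rd d) :
    ∫ x, (η x : ℂ) * Complex.exp (inner ℝ x t * Complex.I) ≠ 0 := by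
  have hi : Integrable fun x => (η x : ℂ) * Complex.exp (inner ℝ x t * Complex.I) := by
    refine h.integrable.ofReal.mul_bdd (c := 1) (by fun_prop) (.of_forall fun x => ?_)
    simp [Complex.norm_exp_ofReal_mul_I]
  intro h0
  have hre := Complex.reCLM.integral_comp_comm hi
  rw [h0] at hre
  have : ∀ x : Rd d, Complex.reCLM ((η x : ℂ) * Complex.exp (inner ℝ x t * Complex.I)) =
      η x * Real.cos (inner ℝ x t) := fun x => by
    rw [Complex.reCLM_apply, Complex.re_ofReal_mul, Complex.exp_ofReal_mul_I_re]
  simp only [this, map_zero] at hre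
  exact (h.cos_transform_pos hκ hpos t).ne' hre

/-- A probability measure is determined, within probability measures, by the line spanned by its
convolution with a companion. -/
theorem eq_of_smear_eq_const_mul (h : IsCompanion κ η c₁ c₂ l₀ l₁) (hκ : Integrable κ)
    (hpos : ∀ z, 0 < κ z) {p q : Measure (Rd d)} [IsProbabilityMeasure p]
    [IsProbabilityMeasure q] {k : ℝ} (hk : ∀ x, smear p η x = k * smear q η x) : p = q := by
  have hchar : ∀ t, charFun p t = k * charFun q t := by
    intro t
    refine mul_left_cancel₀ (h.fourier_ne_zero hκ hpos t) ?_
    rw [← integral_smear_mul_cexp h.integrable, mul_left_comm,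
      ← integral_smear_mul_cexp h.integrable, ← integral_const_mul]
    simp only [hk, Complex.ofReal_mul, mul_assoc]
  -- Both characteristic functions equal `1` at the origin.
  have hk1 : (k : ℂ) = 1 := by simpa using (hchar 0).symm
  refine Measure.ext_of_charFun (funext fun t => ?_)
  rw [hchar, hk1, one_mul]

end IsCompanion

/-! ### Domain of the drift and identification of the measures -/

theorem theorem5p5 {d : ℕ} (κ : Rd d → ℝ) (hκ : CompanionElliptic κ)
    (p q : Measure (Rd d)) [IsProbabilityMeasure p] [IsProbabilityMeasure q] :
    driftDomain κ p q = Set.univ ∧ ((∀ x, driftField κ p q x = 0) → p = q) := by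
  obtain ⟨c₁, c₂, l₀, l₁, η, h⟩ := hκ.exists_companion
  have hb := hκ.memW1Infty.1
  have hdom : driftDomain κ p q = Set.univ := by
    rw [driftDomain, h.barycenterDomain_eq_univ hκ.pos hκ.continuous hb,
      h.barycenterDomain_eq_univ hκ.pos hκ.continuous hb, Set.univ_inter]
  refine ⟨hdom, fun hV => ?_⟩
  have hp := h.ellipticPotential hκ.pos hκ.continuous hb p
  have hq := h.ellipticPotential hκ.pos hκ.continuous hb q
  -- Equality of the barycenters, with the common factor `c₁` removed and the denominators cleared.
  have hprop : ∀ x, smear q κ x • smear p (∇ η) x = smear p κ x • smear q (∇ η) x := by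
    intro x
    have hx := hV ⟨x, hdom ▸ Set.mem_univ x⟩
    simp only [driftField, localBarycenter, add_sub_add_left_eq_sub, sub_eq_zero,
      kernelMass_toReal hκ.pos hκ.continuous, h.centeredMoment_eq] at hx
    rw [smul_comm, smul_comm _ c₁] at hx
    have hx' := smul_right_injective _ h.c₁_pos.ne' hx
    have hup := (hp.source_pos x).ne'
    have huq := (hq.source_pos x).ne'
    calc smear q κ x • smear p (∇ η) x
        = (smear q κ x * smear p κ x) • (smear p κ x)⁻¹ • smear p (∇ η) x := by
          rw [smul_smul, mul_inv_cancel_right₀ hup]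
      _ = (smear p κ x * smear q κ x) • (smear q κ x)⁻¹ • smear q (∇ η) x := by
          rw [mul_comm]
          exact congrArg _ hx'
      _ = smear p κ x • smear q (∇ η) x := by
          rw [smul_smul, mul_inv_cancel_right₀ huq]
  obtain ⟨k, hk⟩ := hp.exists_eq_const_mul hq h.c₂_pos h.l₀_pos h.l₁_nonneg hprop
  exact h.eq_of_smear_eq_const_mul hκ.integrable hκ.pos hk
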